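/- Let $d,m\in\mathbb N$ and $1<p<\infty$. Let $Q=(q_{ij}):\mathbb R^d\to\mathbb R^{d\times d}$, $B^i=(B^i_{hk}):\mathbb R^d\to\mathbb R^{m\times m}$ ($i=1,\dots,d$), $V:\mathbb R^d\to\mathbb R^{m\times m}$, and let $\mathcal A_0 u=\operatorname{div}(Q\nabla u)$, acting componentwise, i.e. $(\mathcal A_0u)_k=\sum_{i,j=1}^d D_i(q_{ij}D_ju_k)$ for $k=1,\dots,m$. Assume: (i) $Q(x)$ is symmetric with entries in $C^1(\mathbb R^d)$ and $\langle Q(x)\xi,\xi\rangle>0$ for all $x\in\mathbb R^d$, $\xi\in\mathbb R^d\setminus\{0\}$; (ii) each $B^i(x)$ is symmetric, with entries in $C^1(\mathbb R^d)$; (iii) $V$ is measurable; (iv) there are $v\in C^1(\mathbb R^d)$ with $c_0:=\inf v>0$ and positive constants $\kappa,c_1$ and $\theta<p$ such that for all $x\in\mathbb R^d$, $\xi\in\mathbb R^m$, $\eta^1,\dots,\eta^m\in\mathbb R^d$ $$\langle V(x)\xi,\xi\rangle\ge v(x)|\xi|^2,\qquad |V(x)\xi|\le c_1v(x)|\xi|,$$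 $$\sum_{h,k=1}^m\Big|\sum_{i=1}^dB^i_{hk}(x)\eta^k_i\Big|\le\kappa\sqrt{v(x)}\sum_{k=1}^m\langle Q(x)\eta^k,\eta^k\rangle^{1/2},\qquad \Big\langle\sum_{i=1}^d D_iB^i(x)\,\xi,\xi\Big\rangle\ge-\theta v(x)|\xi|^2;$$ (v) there are positive constants $\gamma,C_\gamma,c_2$ such that for all $x\in\mathbb R^d$: if $p\le2$, $$\langle Q(x)\nabla v(x),\nabla v(x)\rangle^{1/2}\le\gamma v(x)^{3/2}+C_\gamma;$$ if $p>2$, $$|Q(x)|^{1/2}|\nabla v(x)|\le\gamma v(x)^{3/2}+C_\gamma,\qquad |Q(x)|\le c_2v(x),\qquad \sup_{|x-y|\le\rho(x)}|\nabla Q(y)|\le c_2\,\mu(x)\rho(x)^{-1},$$ where $|Q(x)|$ is the operator norm, $|\nabla Q|=\big(\sum_{i,j,k}|D_iq_{jk}|^2\big)^{1/2}$, $\mu(x)$ is the minimum eigenvalue of $Q(x)$ and $\rho(x)=|Q(x)|^{1/2}v(x)^{-1/2}$; (vi) there are a positive function $\psi\in C^1(\mathbb R^d)$ with $\lim_{|x|\to\infty}\psi(x)=\infty$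 and a constant $C$ such that $\langle Q\nabla\psi,\nabla\psi\rangle\le C\psi^2\log^2\psi$ on $\mathbb R^d$. Assume moreover that $\gamma^2\le\frac4{p-1}$ if $1<p<2$. Then for every $\varepsilon>0$ there is a constant $K_\varepsilon>0$, depending (besides $\varepsilon$ and the dimensions $d,m$) only on $p,\kappa,c_0,c_1,c_2,\gamma,C_\gamma$, such that $$\Big\|\sum_{i=1}^dB^iD_iu\Big\|_{L^p(\mathbb R^d;\mathbb R^m)}\le\varepsilon\,\|\mathcal A_0u\|_{L^p(\mathbb R^d;\mathbb R^m)}+K_\varepsilon\,\|Vu\|_{L^p(\mathbb R^d;\mathbb R^m)}\qquad\text{for all }u\in C_c^\infty(\mathbb R^d;\mathbb R^m).$$ -/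

import Mathlib

open scoped ContDiff ENNReal
open MeasureTheory Filter

noncomputable section

namespace VectorElliptic

/-- The partial derivative `D_i f (x)` of a function on `ℝ^d`. -/
def partialD {d : ℕ} {F : Type*} [NormedAddCommGroup F] [NormedSpace ℝ F]
    (i : Fin d) (f : EuclideanSpace ℝ (Fin d) → F) (x : EuclideanSpace ℝ (Fin d)) : F :=
  fderiv ℝ f x (EuclideanSpace.single i 1)

/-- A square real matrix as an operator on the Euclidean space. The norm of `act A` is the
(Euclidean) operator norm `|A|`. -/
abbrev act {n : ℕ} (A : Matrix (Fin n) (Fin n) ℝ) :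
    EuclideanSpace ℝ (Fin n) →L[ℝ] EuclideanSpace ℝ (Fin n) :=
  Matrix.toEuclideanCLM (n := Fin n) (𝕜 := ℝ) A

/-- The quadratic form `⟨A ξ, ξ⟩`. -/
def quad {n : ℕ} (A : Matrix (Fin n) (Fin n) ℝ) (ξ : EuclideanSpace ℝ (Fin n)) : ℝ :=
  inner ℝ (act A ξ) ξ

/-- The minimum of the (finite) set of real eigenvalues of `A`. -/
def minEigenvalue {n : ℕ} (A : Matrix (Fin n) (Fin n) ℝ) : ℝ :=
  sInf (spectrum ℝ A)

/-- For a symmetric matrix of positive size, `minEigenvalue` is its least eigenvalue. -/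
theorem isLeast_minEigenvalue {n : ℕ} (hn : 0 < n) {A : Matrix (Fin n) (Fin n) ℝ}
    (hA : A.IsSymm) : IsLeast (spectrum ℝ A) (minEigenvalue A) := by
  have hH : A.IsHermitian := by
    rw [Matrix.IsHermitian, Matrix.conjTranspose_eq_transpose_of_trivial]
    exact hA
  have : Nonempty (Fin n) := ⟨⟨0, hn⟩⟩
  have hr := hH.spectrum_real_eq_range_eigenvalues
  have hne : (spectrum ℝ A).Nonempty := hr ▸ Set.range_nonempty _
  have hfin : (spectrum ℝ A).Finite := hr ▸ Set.finite_range _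
  exact ⟨hne.csInf_mem hfin, fun t ht => csInf_le hfin.bddBelow ht⟩

/-- `|∇Q(y)| = (∑_{i,j,k} |D_i q_{jk}(y)|²)^{1/2}`. -/
def gradNorm {d : ℕ} (Q : EuclideanSpace ℝ (Fin d) → Matrix (Fin d) (Fin d) ℝ)
    (y : EuclideanSpace ℝ (Fin d)) : ℝ :=
  Real.sqrt (∑ i, ∑ j, ∑ k, (partialD i (fun z => Q z j k) y) ^ 2)

/-- The radius `ρ(x) = |Q(x)|^{1/2} v(x)^{-1/2}`. -/
def radius {d : ℕ} (Q : EuclideanSpace ℝ (Fin d) → Matrix (Fin d) (Fin d) ℝ)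
    (v : EuclideanSpace ℝ (Fin d) → ℝ) (x : EuclideanSpace ℝ (Fin d)) : ℝ :=
  Real.sqrt ‖act (Q x)‖ / Real.sqrt (v x)

/-- `div B = ∑_i D_i B^i`, the derivatives being taken entrywise. -/
def divB {d m : ℕ} (B : Fin d → EuclideanSpace ℝ (Fin d) → Matrix (Fin m) (Fin m) ℝ)
    (x : EuclideanSpace ℝ (Fin d)) : Matrix (Fin m) (Fin m) ℝ :=
  Matrix.of fun h k => ∑ i, partialD i (fun y => B i y h k) x

/-- `A₀ u = div (Q ∇u)`, acting componentwise:
`(A₀ u)_k = ∑_i D_i (∑_j q_{ij} D_j u_k)`. -/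
def opA0 {d m : ℕ} (Q : EuclideanSpace ℝ (Fin d) → Matrix (Fin d) (Fin d) ℝ)
    (u : EuclideanSpace ℝ (Fin d) → EuclideanSpace ℝ (Fin m))
    (x : EuclideanSpace ℝ (Fin d)) : EuclideanSpace ℝ (Fin m) :=
  WithLp.toLp 2 fun k =>
    ∑ i, partialD i (fun y => ∑ j, Q y i j * partialD j (fun z => u z k) y) x

/-- The first order term `∑_i B^i D_i u`. -/
def drift {d m : ℕ} (B : Fin d → EuclideanSpace ℝ (Fin d) → Matrix (Fin m) (Fin m) ℝ)
    (u : EuclideanSpace ℝ (Fin d) → EuclideanSpace ℝ (Fin m))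
    (x : EuclideanSpace ℝ (Fin d)) : EuclideanSpace ℝ (Fin m) :=
  ∑ i, act (B i x) (partialD i u x)

/-- The standing assumptions on the coefficients `Q`, `B^i`, `V` and on the auxiliary
potential `v`, with the exponent `p` and all the constants displayed. -/
structure Hyp {d m : ℕ} (p κ θ c₀ c₁ c₂ γ Cγ : ℝ)
    (Q : EuclideanSpace ℝ (Fin d) → Matrix (Fin d) (Fin d) ℝ)
    (B : Fin d → EuclideanSpace ℝ (Fin d) → Matrix (Fin m) (Fin m) ℝ)
    (V : EuclideanSpace ℝ (Fin d) → Matrix (Fin m) (Fin m) ℝ)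
    (v : EuclideanSpace ℝ (Fin d) → ℝ) : Prop where
  -- (i)
  Q_symm : ∀ x, (Q x).IsSymm
  Q_smooth : ∀ i j, ContDiff ℝ 1 (fun x => Q x i j)
  Q_pos : ∀ x ξ, ξ ≠ 0 → 0 < quad (Q x) ξ
  -- (ii)
  B_symm : ∀ i x, (B i x).IsSymm
  B_smooth : ∀ i h k, ContDiff ℝ 1 (fun x => B i x h k)
  -- (iii): Lebesgue measurability
  V_meas : ∀ h k, AEMeasurable (fun x => V x h k) volume
  -- (iv)
  v_smooth : ContDiff ℝ 1 v
  v_inf : IsGLB (Set.range v) c₀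
  c₀_pos : 0 < c₀
  κ_pos : 0 < κ
  c₁_pos : 0 < c₁
  θ_pos : 0 < θ
  θ_lt : θ < p
  V_lower : ∀ x ξ, v x * ‖ξ‖ ^ 2 ≤ quad (V x) ξ
  V_upper : ∀ x ξ, ‖act (V x) ξ‖ ≤ c₁ * v x * ‖ξ‖
  B_bound : ∀ x (η : Fin m → EuclideanSpace ℝ (Fin d)),
    ∑ h, ∑ k, |∑ i, B i x h k * η k i| ≤
      κ * Real.sqrt (v x) * ∑ k, Real.sqrt (quad (Q x) (η k))
  divB_lower : ∀ x ξ, -θ * v x * ‖ξ‖ ^ 2 ≤ quad (divB B x) ξ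
  -- (v)
  γ_pos : 0 < γ
  Cγ_pos : 0 < Cγ
  c₂_pos : 0 < c₂
  osc_le : p ≤ 2 → ∀ x,
    Real.sqrt (quad (Q x) (gradient v x)) ≤ γ * v x ^ (3 / 2 : ℝ) + Cγ
  osc_gt : 2 < p → ∀ x,
    Real.sqrt ‖act (Q x)‖ * ‖gradient v x‖ ≤ γ * v x ^ (3 / 2 : ℝ) + Cγ
  Q_growth : 2 < p → ∀ x, ‖act (Q x)‖ ≤ c₂ * v x
  Q_osc : 2 < p → ∀ x y, ‖x - y‖ ≤ radius Q v x →
    gradNorm Q y ≤ c₂ * minEigenvalue (Q x) / radius Q v x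
  -- (vi)
  lyapunov : ∃ (ψ : EuclideanSpace ℝ (Fin d) → ℝ) (C : ℝ),
    ContDiff ℝ 1 ψ ∧ (∀ x, 0 < ψ x) ∧ Tendsto ψ (cocompact _) atTop ∧
      ∀ x, quad (Q x) (gradient ψ x) ≤ C * ψ x ^ 2 * Real.log (ψ x) ^ 2

end VectorElliptic

end

noncomputable section

namespace VectorElliptic

/-! ### Partial derivatives and integration by parts on Euclidean space. -/

section Calculus

variable {d : ℕ}

local notation "𝔼" => EuclideanSpace ℝ (Fin d)

/-! The bound on the matrices B^i dominates |∑ B^i D_i u| by κ √v ∑_k √E_k, with E_k = ⟨Q∇u_k, ∇u_k⟩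
(`Hyp.norm_drift_le`), and the lower bound on V gives v|u| ≤ |Vu|. The system thus decouples, and
everything rests on a scalar interpolation inequality (`exists_eLpNorm_energy_le`): the L^p norm of
√v √E is at most ε ‖A‖_p + K ‖vu‖_p, where X = Q∇u, A = div X and E = ⟨Q∇u, ∇u⟩. Since v ≥ c₀ > 0,
the constant C_γ can be merged into γ v^{3/2}.

For p ≤ 2 one tests A against v^{p-1} u (u² + δ)^{(p-2)/2}. The main term is τ^{(p-2)/2} vE with τ =
v²(u² + δ). The term with ∇v is absorbed by Cauchy-Schwarz and the term with A by Young's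
inequality, and (vE)^{p/2} ≤ τ^{(p-2)/2} vE + τ^{p/2} recovers the desired power
(`subquadratic_integrand_lower`).

For p > 2 the weight W = (vE + δ)^{(p-2)/2} depends on ∇u. Testing against u v W produces W vE, but
also second derivatives of u through ∇W. They are paid for by a small multiple of a Bochner identity
with the same weight (`integral_weighted_hessian`), which controls W tr(QDQD), with D the Hessian of
u, up to terms in vE and A². The condition on ∇Q makes the derivatives of the coefficients harmless
(`exists_hessian_bounds`). Choosing the multiple small enough closes the estimate
(`exists_absorption`), and Young's inequality turns the weighted quadratic bound into p-th powers.

In both cases the constants do not depend on δ, which finally tends to 0. -/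

lemma partialD_mul {f g : 𝔼 → ℝ} {x : 𝔼} (i : Fin d) (hf : DifferentiableAt ℝ f x)
    (hg : DifferentiableAt ℝ g x) :
    partialD i (fun y => f y * g y) x = partialD i f x * g x + f x * partialD i g x := by
  unfold partialD
  rw [fderiv_fun_mul hf hg]
  simp
  ring

lemma partialD_sum {ι : Type*} {s : Finset ι} {f : ι → 𝔼 → ℝ} {x : 𝔼} (i : Fin d)
    (hf : ∀ j ∈ s, DifferentiableAt ℝ (f j) x) :
    partialD i (fun y => ∑ j ∈ s, f j y) x = ∑ j ∈ s, partialD i (f j) x := by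
  unfold partialD
  rw [fderiv_fun_sum hf]
  simp

lemma partialD_comp {φ : ℝ → ℝ} {f : 𝔼 → ℝ} {x : 𝔼} {φ' : ℝ} (i : Fin d)
    (hφ : HasDerivAt φ φ' (f x)) (hf : DifferentiableAt ℝ f x) :
    partialD i (fun y => φ (f y)) x = φ' * partialD i f x := by
  unfold partialD
  have := (hφ.comp_hasFDerivAt x hf.hasFDerivAt).fderiv
  rw [show (fun y => φ (f y)) = φ ∘ f from rfl, this]
  simp

lemma partialD_add_const {f : 𝔼 → ℝ} {x : 𝔼} (i : Fin d) (c : ℝ) :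
    partialD i (fun y => f y + c) x = partialD i f x := by
  unfold partialD
  rw [fderiv_add_const]

lemma _root_.ContDiff.partialD {f : 𝔼 → ℝ} {n k : WithTop ℕ∞} (hf : ContDiff ℝ n f)
    (hk : k + 1 ≤ n) (i : Fin d) : ContDiff ℝ k (partialD i f) :=
  (hf.fderiv_right hk).clm_apply contDiff_const

lemma continuous_partialD {f : 𝔼 → ℝ} (hf : ContDiff ℝ 1 f) (i : Fin d) :
    Continuous (partialD i f) :=
  (hf.partialD (k := 0) (by simp) i).continuous

lemma tsupport_partialD_subset (f : 𝔼 → ℝ) (i : Fin d) :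
    tsupport (partialD i f) ⊆ tsupport f :=
  tsupport_fderiv_apply_subset ℝ _

lemma _root_.HasCompactSupport.partialD {f : 𝔼 → ℝ} (hf : HasCompactSupport f) (i : Fin d) :
    HasCompactSupport (partialD i f) :=
  hf.fderiv_apply ℝ _

lemma partialD_comm {f : 𝔼 → ℝ} (hf : ContDiff ℝ 2 f) (i j : Fin d) (x : 𝔼) :
    partialD i (partialD j f) x = partialD j (partialD i f) x := by
  have h : DifferentiableAt ℝ (fderiv ℝ f) x :=
    ((hf.fderiv_right (m := 1) (by norm_num)).differentiable one_ne_zero) x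
  have key : ∀ a b : Fin d, partialD a (partialD b f) x =
      fderiv ℝ (fderiv ℝ f) x (EuclideanSpace.single a 1) (EuclideanSpace.single b 1) := by
    intro a b
    unfold VectorElliptic.partialD
    rw [fderiv_clm_apply h (differentiableAt_const _)]
    simp
  rw [key, key]
  exact (hf.contDiffAt.isSymmSndFDerivAt (by simp)).eq _ _

lemma integral_partialD_eq_zero {f : 𝔼 → ℝ} (hf : ContDiff ℝ 1 f) (hc : HasCompactSupport f)
    (i : Fin d) : ∫ x, partialD i f x = 0 := by
  have hi : Integrable (fun x => fderiv ℝ f x (EuclideanSpace.single i 1)) :=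
    (continuous_partialD hf i).integrable_of_hasCompactSupport (hc.partialD i)
  have h := integral_mul_fderiv_eq_neg_fderiv_mul_of_integrable (μ := (volume : Measure 𝔼))
    (f := fun _ => (1 : ℝ)) (g := f) (v := EuclideanSpace.single i 1) (by simp)
    (by simpa using hi)
    (by simpa using hf.continuous.integrable_of_hasCompactSupport hc)
    (fun _ _ => differentiableAt_const _) (fun x _ => hf.differentiable one_ne_zero x)
  simpa [partialD] using h

lemma integral_partialD_mul_eq {f g : 𝔼 → ℝ} (hf : ContDiff ℝ 1 f) (hg : ContDiff ℝ 1 g)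
    (hc : HasCompactSupport f) (i : Fin d) :
    ∫ x, partialD i f x * g x = - ∫ x, f x * partialD i g x := by
  have h := integral_partialD_eq_zero (hf.mul hg) hc.mul_right i
  have e : ∀ x, partialD i (fun y => f y * g y) x
      = partialD i f x * g x + f x * partialD i g x := fun x =>
    partialD_mul i (hf.differentiable one_ne_zero x) (hg.differentiable one_ne_zero x)
  rw [integral_congr_ae (Eventually.of_forall e), integral_add] at h
  · linarith
  · exact ((continuous_partialD hf i).mul hg.continuous).integrable_of_hasCompactSupport
      (hc.partialD i).mul_right
  · exact (hf.continuous.mul (continuous_partialD hg i)).integrable_of_hasCompactSupport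
      hc.mul_right

lemma lineDeriv_eq_partialD {f : 𝔼 → ℝ} (hf : ContDiff ℝ 1 f) (i : Fin d) (x : 𝔼) :
    lineDeriv ℝ f x (EuclideanSpace.single i 1) = partialD i f x :=
  (hf.differentiable one_ne_zero x).lineDeriv_eq_fderiv

lemma lineDeriv_neg_eq_partialD {f : 𝔼 → ℝ} (hf : ContDiff ℝ 1 f) (i : Fin d) (x : 𝔼) :
    lineDeriv ℝ f x (-EuclideanSpace.single i 1) = -partialD i f x := by
  rw [(hf.differentiable one_ne_zero x).lineDeriv_eq_fderiv, map_neg]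
  rfl

lemma partialD_comp_add_const {f : 𝔼 → ℝ} (i : Fin d) (x a : 𝔼) :
    partialD i (fun y => f (y + a)) x = partialD i f (x + a) := by
  unfold partialD
  rw [fderiv_comp_add_right]

/-- Two first order derivatives may be exchanged under the integral, although the functions are
only of class `C¹`. -/
lemma integral_partialD_mul_partialD_comm {f g : 𝔼 → ℝ} (hf : ContDiff ℝ 1 f)
    (hg : ContDiff ℝ 1 g) (hcf : HasCompactSupport f) (hcg : HasCompactSupport g)
    (i k : Fin d) :
    ∫ x, partialD k f x * partialD i g x = ∫ x, partialD i f x * partialD k g x := by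
  obtain ⟨C, hC⟩ := hf.lipschitzWith_of_hasCompactSupport hcf one_ne_zero
  obtain ⟨C', hC'⟩ := hg.lipschitzWith_of_hasCompactSupport hcg one_ne_zero
  set e : 𝔼 := EuclideanSpace.single k 1 with he
  have A := hC.integral_inv_smul_sub_mul_tendsto_integral_lineDeriv_mul (μ := volume)
    ((continuous_partialD hg i).integrable_of_hasCompactSupport (hcg.partialD i)) e
  have B := hC'.integral_inv_smul_sub_mul_tendsto_integral_lineDeriv_mul (μ := volume)
    ((continuous_partialD hf i).integrable_of_hasCompactSupport (hcf.partialD i)) (-e)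
  -- Two integrations by parts in direction `i` and a translation carry the difference quotient in
  -- direction `k` from `f` to `g`, so no second derivative appears. Both sides converge as t → 0+
  -- because `f` and `g` are Lipschitz.
  have S : ∀ t : ℝ, ∫ x, (t⁻¹ • (f (x + t • e) - f x)) * partialD i g x =
      - ∫ x, (t⁻¹ • (g (x + t • (-e)) - g x)) * partialD i f x := by
    intro t
    have htf : ContDiff ℝ 1 fun x => f (x + t • e) := hf.comp (contDiff_id.add contDiff_const)
    have hcf' : HasCompactSupport fun x => f (x + t • e) :=
      hcf.comp_homeomorph (Homeomorph.addRight (t • e))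
    have hcg' : HasCompactSupport fun x => g (x + t • (-e)) :=
      hcg.comp_homeomorph (Homeomorph.addRight (t • (-e)))
    have S1 : ∫ x, f (x + t • e) * partialD i g x =
        - ∫ x, partialD i f x * g (x + t • (-e)) := by
      have h := integral_partialD_mul_eq htf hg hcf' i
      rw [← neg_eq_iff_eq_neg.mpr h]
      simp only [partialD_comp_add_const]
      rw [← integral_add_right_eq_self _ (t • (-e))]
      simp
    have S2 := integral_partialD_mul_eq hf hg hcf i
    have cf := hf.continuous
    have cg := hg.continuous
    have cpf := continuous_partialD hf i
    have cpg := continuous_partialD hg i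
    have S3 : ∫ x, (f (x + t • e) - f x) * partialD i g x =
        - ∫ x, (g (x + t • (-e)) - g x) * partialD i f x := by
      simp_rw [sub_mul]
      rw [integral_sub, integral_sub, S1, ← neg_eq_iff_eq_neg.mpr S2]
      · simp_rw [mul_comm (partialD i f _)]
        ring
      · exact Continuous.integrable_of_hasCompactSupport (by fun_prop) hcg'.mul_right
      · exact Continuous.integrable_of_hasCompactSupport (by fun_prop) hcg.mul_right
      · exact Continuous.integrable_of_hasCompactSupport (by fun_prop) hcf'.mul_right
      · exact Continuous.integrable_of_hasCompactSupport (by fun_prop) hcf.mul_right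
    simp only [smul_eq_mul, mul_assoc, integral_const_mul, S3]
    ring
  simp only [S] at A
  have := tendsto_nhds_unique A B.neg
  simp only [he, lineDeriv_eq_partialD hf, lineDeriv_neg_eq_partialD hg] at this
  rw [this, ← integral_neg]
  congr 1 with x
  ring

end Calculus

/-! ### Quadratic forms, Frobenius norms and the least eigenvalue. -/

section LinearAlgebra

variable {d : ℕ}

local notation "𝔼" => EuclideanSpace ℝ (Fin d)
local notation "𝕄" => Matrix (Fin d) (Fin d) ℝ

lemma act_apply (A : 𝕄) (z : 𝔼) (i : Fin d) : act A z i = ∑ j, A i j * z j := by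
  simp [act, Matrix.ofLp_toEuclideanCLM, Matrix.mulVec, dotProduct]

lemma act_mul (A B : 𝕄) (z : 𝔼) : act (A * B) z = act A (act B z) := by
  simp [act, map_mul]

lemma act_add (A B : 𝕄) (z : 𝔼) : act (A + B) z = act A z + act B z := by
  simp [act, map_add]

lemma inner_eq_sum (x y : 𝔼) : inner ℝ x y = ∑ i, x i * y i := by
  simp [PiLp.inner_apply, mul_comm]

lemma norm_sq_eq_sum (x : 𝔼) : ‖x‖ ^ 2 = ∑ i, x i ^ 2 := by
  simp [EuclideanSpace.norm_sq_eq]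

lemma inner_act_transpose (A : 𝕄) (x y : 𝔼) :
    inner ℝ (act A.transpose x) y = inner ℝ x (act A y) := by
  simp only [inner_eq_sum, act_apply, Matrix.transpose_apply, Finset.sum_mul, Finset.mul_sum]
  rw [Finset.sum_comm]
  exact Finset.sum_congr rfl fun i _ => Finset.sum_congr rfl fun j _ => by ring

lemma quad_eq_sum (A : 𝕄) (ξ : 𝔼) : quad A ξ = ∑ i, (∑ j, A i j * ξ j) * ξ i := by
  simp only [quad, inner_eq_sum, act_apply]

/-- The Frobenius norm of a matrix. -/
def frob (A : 𝕄) : ℝ := Real.sqrt (∑ i, ∑ j, A i j ^ 2)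

lemma frob_nonneg (A : 𝕄) : 0 ≤ frob A := Real.sqrt_nonneg _

lemma frob_sq (A : 𝕄) : frob A ^ 2 = ∑ i, ∑ j, A i j ^ 2 :=
  Real.sq_sqrt (Finset.sum_nonneg fun _ _ => Finset.sum_nonneg fun _ _ => sq_nonneg _)

lemma frob_transpose (A : 𝕄) : frob A.transpose = frob A := by
  unfold frob
  rw [Finset.sum_comm]
  rfl

lemma norm_act_le_frob (A : 𝕄) (z : 𝔼) : ‖act A z‖ ≤ frob A * ‖z‖ := by
  refine le_of_sq_le_sq ?_ (mul_nonneg (frob_nonneg A) (norm_nonneg z))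
  rw [mul_pow, frob_sq, norm_sq_eq_sum, norm_sq_eq_sum, Finset.sum_mul]
  refine Finset.sum_le_sum fun i _ => ?_
  rw [act_apply]
  exact Finset.sum_mul_sq_le_sq_mul_sq _ _ _

/-- The Cauchy-Schwarz inequality for `tr (A B)`. -/
lemma abs_sum_mul_transpose_le (A B : 𝕄) : |∑ i, ∑ j, A i j * B j i| ≤ frob A * frob B := by
  refine abs_le_of_sq_le_sq ?_ (mul_nonneg (frob_nonneg A) (frob_nonneg B))
  rw [← frob_transpose B, mul_pow, frob_sq, frob_sq]
  simp only [← Finset.sum_product', Matrix.transpose_apply]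
  exact Finset.sum_mul_sq_le_sq_mul_sq _ _ _

/-- If `A` has operator bound `S`, then `|A M| ≤ S |M|` in the Frobenius norm. -/
lemma frob_mul_le {A M : 𝕄} {S : ℝ} (hS : 0 ≤ S) (hA : ∀ z, ‖act A z‖ ≤ S * ‖z‖) :
    frob (A * M) ≤ S * frob M := by
  refine le_of_sq_le_sq ?_ (mul_nonneg hS (frob_nonneg M))
  rw [mul_pow, frob_sq, frob_sq, Finset.sum_comm, Finset.sum_comm (f := fun i j => M i j ^ 2),
    Finset.mul_sum]
  refine Finset.sum_le_sum fun j _ => ?_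
  have h := pow_le_pow_left₀ (norm_nonneg _) (hA (WithLp.toLp 2 fun i => M i j)) 2
  rw [mul_pow, norm_sq_eq_sum, norm_sq_eq_sum] at h
  simpa only [act_apply, Matrix.mul_apply] using h

/-- If `A` is bounded below by `s`, then `s |M| ≤ |M Aᵀ|` in the Frobenius norm. -/
lemma mul_frob_le {A M : 𝕄} {s : ℝ} (hs : 0 ≤ s) (hA : ∀ z, s * ‖z‖ ≤ ‖act A z‖) :
    s * frob M ≤ frob (M * A.transpose) := by
  refine le_of_sq_le_sq ?_ (frob_nonneg _)
  rw [mul_pow, frob_sq, frob_sq, Finset.mul_sum]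
  refine Finset.sum_le_sum fun i _ => ?_
  have h := pow_le_pow_left₀ (by positivity) (hA (WithLp.toLp 2 fun j => M i j)) 2
  rw [mul_pow, norm_sq_eq_sum, norm_sq_eq_sum] at h
  simpa only [act_apply, Matrix.mul_apply, Matrix.transpose_apply, mul_comm] using h

lemma isHermitian_of_isSymm {Q : 𝕄} (hQ : Q.IsSymm) : Q.IsHermitian := by
  rw [Matrix.IsHermitian, Matrix.conjTranspose_eq_transpose_of_trivial]
  exact hQ

lemma quad_eq_dotProduct (A : 𝕄) (x : 𝔼) :
    quad A x = dotProduct (star x.ofLp) (A.mulVec x.ofLp) := by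
  rw [quad_eq_sum]
  simp [dotProduct, Matrix.mulVec, mul_comm]

lemma posSemidef_of_quad_nonneg {Q : 𝕄} (hQ : Q.IsSymm) (hpos : ∀ ξ, 0 ≤ quad Q ξ) :
    Q.PosSemidef :=
  Matrix.PosSemidef.of_dotProduct_mulVec_nonneg (isHermitian_of_isSymm hQ) fun x => by
    simpa only [quad_eq_dotProduct] using hpos (WithLp.toLp 2 x)

lemma posDef_of_quad_pos {Q : 𝕄} (hQ : Q.IsSymm) (hpos : ∀ ξ, ξ ≠ 0 → 0 < quad Q ξ) :
    Q.PosDef :=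
  Matrix.PosDef.of_dotProduct_mulVec_pos (isHermitian_of_isSymm hQ) fun x hx => by
    have := hpos (WithLp.toLp 2 x) (by simpa using hx)
    simpa only [quad_eq_dotProduct] using this

/-- Any such factor serves as a square root of `Q`: the estimates only need |Rz|² = ⟨Qz, z⟩ and |R|²
= |Q|, not the symmetry of `R`. -/
lemma exists_eq_transpose_mul {Q : 𝕄} (hQ : Q.IsSymm) (hpos : ∀ ξ, 0 ≤ quad Q ξ) :
    ∃ R : 𝕄, Q = R.transpose * R := by
  open scoped MatrixOrder Matrix.Norms.L2Operator in
  obtain ⟨R, hR⟩ := CStarAlgebra.nonneg_iff_eq_star_mul_self.mp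
    (posSemidef_of_quad_nonneg hQ hpos).nonneg
  exact ⟨R, by simpa [Matrix.star_eq_conjTranspose] using hR⟩

/-- Subtracting the least eigenvalue times the identity leaves a symmetric matrix with nonnegative
spectrum, hence a positive semidefinite one. -/
lemma minEigenvalue_mul_le_quad {Q : 𝕄} (hQ : Q.IsSymm) (z : 𝔼) :
    minEigenvalue Q * ‖z‖ ^ 2 ≤ quad Q z := by
  rcases Nat.eq_zero_or_pos d with rfl | hd
  · simp [Subsingleton.elim z 0, quad]
  have hl := isLeast_minEigenvalue hd hQ
  have hp : (Q - algebraMap ℝ 𝕄 (minEigenvalue Q)).PosSemidef := by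
    rw [Matrix.posSemidef_iff_isHermitian_and_spectrum_nonneg]
    refine ⟨isHermitian_of_isSymm ?_, ?_⟩
    · refine hQ.sub ?_
      rw [Matrix.algebraMap_eq_diagonal]
      exact Matrix.isSymm_diagonal _
    · rw [← spectrum.sub_singleton_eq]
      rintro _ ⟨t, ht, _, rfl, rfl⟩
      exact sub_nonneg.mpr (hl.2 ht)
  have h : (0 : ℝ) ≤ quad (Q - algebraMap ℝ 𝕄 (minEigenvalue Q)) z := by
    rw [quad_eq_dotProduct]
    exact hp.dotProduct_mulVec_nonneg _
  have e : quad (Q - algebraMap ℝ 𝕄 (minEigenvalue Q)) z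
      = quad Q z - minEigenvalue Q * ‖z‖ ^ 2 := by
    simp [quad, act, map_sub, Algebra.algebraMap_eq_smul_one, inner_sub_left, inner_smul_left]
  linarith

lemma minEigenvalue_pos (hd : 0 < d) {Q : 𝕄} (hQ : Q.IsSymm)
    (hpos : ∀ ξ, ξ ≠ 0 → 0 < quad Q ξ) : 0 < minEigenvalue Q := by
  have h := (isLeast_minEigenvalue hd hQ).1
  rw [(isHermitian_of_isSymm hQ).spectrum_real_eq_range_eigenvalues] at h
  obtain ⟨i, hi⟩ := h
  rw [← hi]
  exact (posDef_of_quad_pos hQ hpos).eigenvalues_pos i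

end LinearAlgebra

/-! ### Pointwise bounds for the first and second order terms. -/

section PointwiseBounds

variable {d : ℕ}

local notation "𝔼" => EuclideanSpace ℝ (Fin d)
local notation "𝕄" => Matrix (Fin d) (Fin d) ℝ

lemma norm_act_factor {Q R : 𝕄} (hR : Q = R.transpose * R) (z : 𝔼) :
    ‖act R z‖ = Real.sqrt (quad Q z) := by
  rw [quad, hR, act_mul, inner_act_transpose, real_inner_self_eq_norm_sq,
    Real.sqrt_sq (norm_nonneg _)]

lemma norm_act_eq_sq {Q R : 𝕄} (hR : Q = R.transpose * R) : ‖act R‖ ^ 2 = ‖act Q‖ := by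
  have h : act Q = star (act R) * act R := by
    rw [hR]
    simp only [act, map_mul, ← map_star, Matrix.star_eq_conjTranspose,
      Matrix.conjTranspose_eq_transpose_of_trivial]
  rw [h, sq]
  exact (CStarRing.norm_star_mul_self (x := act R)).symm

lemma norm_act_transpose (R : 𝕄) : ‖act R.transpose‖ = ‖act R‖ := by
  have h : act R.transpose = star (act R) := by
    simp only [act, ← map_star, Matrix.star_eq_conjTranspose,
      Matrix.conjTranspose_eq_transpose_of_trivial]
  rw [h]
  exact norm_star (act R)

/-- The Cauchy-Schwarz inequality for the form `⟨Q ·, ·⟩`. -/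
lemma abs_inner_act_le {Q : 𝕄} (hQ : Q.IsSymm) (hpos : ∀ ξ, 0 ≤ quad Q ξ) (x y : 𝔼) :
    |inner ℝ (act Q x) y| ≤ Real.sqrt (quad Q x) * Real.sqrt (quad Q y) := by
  obtain ⟨R, hR⟩ := exists_eq_transpose_mul hQ hpos
  rw [← norm_act_factor hR, ← norm_act_factor hR]
  conv_lhs => rw [hR, act_mul, inner_act_transpose]
  exact abs_real_inner_le_norm _ _

/-- `tr (A²)` expanded for `A = M + E`. -/
lemma sum_add_mul_add (M E : 𝕄) :
    ∑ i, ∑ j, (M + E) i j * (M + E) j i =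
      ∑ i, ∑ j, M i j * M j i + 2 * (∑ i, ∑ j, M i j * E j i) + ∑ i, ∑ j, E i j * E j i := by
  have h : ∑ i, ∑ j, E i j * M j i = ∑ i, ∑ j, M i j * E j i := by
    rw [Finset.sum_comm]
    simp only [mul_comm]
  rw [two_mul]
  nth_rewrite 2 [← h]
  simp only [← Finset.sum_add_distrib, Matrix.add_apply]
  exact Finset.sum_congr rfl fun i _ => Finset.sum_congr rfl fun j _ => by ring

/-- Bounds for the quantities built from a positive definite matrix `Q`, a symmetric matrix `D`
(a Hessian), a vector `ξ` (a gradient), a perturbation `E` and a vector `w`, in terms of the norm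
`h = tr(QDQD)^{1/2}` and of `G = ⟨Qξ,ξ⟩^{1/2}`. -/
lemma exists_hessian_bounds {Q D E : 𝕄} {ξ w : 𝔼} {μ N c e G T : ℝ} (hQ : Q.IsSymm)
    (hD : D.IsSymm) (hμ : 0 < μ) (hQμ : ∀ z, μ * ‖z‖ ^ 2 ≤ quad Q z) (hd : 0 < d)
    (hG : G = Real.sqrt (quad Q ξ)) (hc : 0 ≤ c) (he : e = c * G) (hE : frob E ≤ N * ‖ξ‖)
    (hN : N * Real.sqrt ‖act Q‖ ≤ c * μ)
    (hw : Real.sqrt ‖act Q‖ * ‖w‖ ≤ T) :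
    ∃ h : ℝ, 0 ≤ h ∧
      h ^ 2 - 2 * e * h - e ^ 2 ≤ ∑ i, ∑ j, (Q * D + E) i j * (Q * D + E) j i ∧
      |inner ℝ w (act (Q * D + E) (act Q ξ))| ≤ T * (h + e) * G ∧
      -((3 * h * e + e ^ 2) * G ^ 2) ≤
        inner ℝ ((2 : ℝ) • act D (act Q ξ) + act E.transpose ξ) (act (Q * D + E) (act Q ξ)) ∧
      |inner ℝ (act Q ξ) w| ≤ T * G ∧
      |inner ℝ (act Q ξ) ((2 : ℝ) • act D (act Q ξ) + act E.transpose ξ)| ≤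
        (2 * h + e) * G ^ 2 := by
  have hpos : ∀ z, 0 ≤ quad Q z := fun z => (by positivity : 0 ≤ μ * ‖z‖ ^ 2).trans (hQμ z)
  obtain ⟨R, hR⟩ := exists_eq_transpose_mul hQ hpos
  set S := Real.sqrt ‖act Q‖ with hS
  set m := Real.sqrt μ with hm
  have hS0 : 0 ≤ S := Real.sqrt_nonneg _
  have hm0 : 0 < m := Real.sqrt_pos.mpr hμ
  have hmm : m * m = μ := Real.mul_self_sqrt hμ.le
  have hG0 : 0 ≤ G := hG ▸ Real.sqrt_nonneg _
  have he0 : 0 ≤ e := he ▸ mul_nonneg hc hG0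
  have hRS : ‖act R‖ = S := by rw [hS, ← norm_act_eq_sq hR, Real.sqrt_sq (norm_nonneg _)]
  have hRle : ∀ z, ‖act R z‖ ≤ S * ‖z‖ := fun z => hRS ▸ (act R).le_opNorm z
  have hRtle : ∀ z, ‖act R.transpose z‖ ≤ S * ‖z‖ := fun z =>
    hRS ▸ norm_act_transpose R ▸ (act R.transpose).le_opNorm z
  have hRge : ∀ z, m * ‖z‖ ≤ ‖act R z‖ := fun z => by
    rw [norm_act_factor hR]
    refine Real.le_sqrt_of_sq_le ?_
    rw [mul_pow, sq m, hmm]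
    exact hQμ z
  have hmS : m ≤ S := by
    have h1 := (hRge (EuclideanSpace.single ⟨0, hd⟩ 1)).trans (hRle _)
    simpa using h1
  have hGR : ‖act R ξ‖ = G := by rw [norm_act_factor hR, hG]
  have hX : act Q ξ = act R.transpose (act R ξ) := by
    conv_lhs => rw [hR, act_mul]
  have hXn : ‖act Q ξ‖ ≤ S * G := by rw [hX, ← hGR]; exact hRtle _
  have hξ : m * ‖ξ‖ ≤ G := hGR ▸ hRge ξ
  set F := frob E with hF
  have hF0 : 0 ≤ F := frob_nonneg E
  -- The condition on ∇Q enters here. Passing between `R` and the identity costs a factor S/m, the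
  -- square root of the condition number of `Q`; this bound on `E` compensates exactly that loss.
  have hFS : F * S ≤ e * m := by
    calc F * S ≤ N * ‖ξ‖ * S := by gcongr
      _ = N * S * ‖ξ‖ := by ring
      _ ≤ c * μ * ‖ξ‖ := by gcongr
      _ = c * m * (m * ‖ξ‖) := by rw [← hmm]; ring
      _ ≤ c * m * G := by gcongr
      _ = e * m := by rw [he]; ring
  have hFe : F ≤ e := by
    refine le_of_mul_le_mul_right (a := m) ?_ hm0
    exact (mul_le_mul_of_nonneg_left hmS hF0).trans hFS
  -- The Hessian seen through `R`: tr(QDQD) is the squared Frobenius norm of this symmetric matrix.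
  set H : 𝕄 := R * D * R.transpose with hH
  set h := frob H with hh
  have hh0 : 0 ≤ h := frob_nonneg H
  set X := act Q ξ with hXdef
  have hRD : act R (act D X) = act H (act R ξ) := by
    rw [hX, ← act_mul, ← act_mul, ← act_mul]
  have hDX' : ‖act R (act D X)‖ ≤ h * G := by
    rw [hRD, ← hGR]; exact norm_act_le_frob _ _
  have hDX : m * ‖act D X‖ ≤ h * G := (hRge _).trans hDX'
  have hQDX : ‖act (Q * D) X‖ ≤ S * (h * G) := by
    rw [act_mul]
    conv_lhs => rw [hR, act_mul]
    exact (hRtle _).trans (by gcongr)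
  have hEX : ‖act E X‖ ≤ e * m * G := by
    calc ‖act E X‖ ≤ F * ‖X‖ := norm_act_le_frob _ _
      _ ≤ F * (S * G) := by gcongr
      _ = F * S * G := by ring
      _ ≤ e * m * G := by gcongr
  have hEX' : ‖act E X‖ ≤ S * (e * G) := by
    refine hEX.trans ?_
    calc e * m * G = m * (e * G) := by ring
      _ ≤ S * (e * G) := by gcongr
  have hEξ : S * ‖act E.transpose ξ‖ ≤ e * G := by
    calc S * ‖act E.transpose ξ‖ ≤ S * (F * ‖ξ‖) := by
          gcongr
          exact (norm_act_le_frob _ _).trans_eq (by rw [frob_transpose])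
      _ = F * S * ‖ξ‖ := by ring
      _ ≤ e * m * ‖ξ‖ := by gcongr
      _ = e * (m * ‖ξ‖) := by ring
      _ ≤ e * G := by gcongr
  have hYX : ‖act (Q * D + E) X‖ ≤ S * ((h + e) * G) := by
    rw [act_add]
    calc _ ≤ S * (h * G) + S * (e * G) := (norm_add_le _ _).trans (add_le_add hQDX hEX')
      _ = _ := by ring
  have hT0 : 0 ≤ T := (mul_nonneg hS0 (norm_nonneg w)).trans hw
  refine ⟨h, hh0, ?_, ?_, ?_, ?_, ?_⟩
  · have htr : ∑ i, ∑ j, (Q * D) i j * (Q * D) j i = h ^ 2 := by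
      have h1 : ∀ A : 𝕄, ∑ i, ∑ j, A i j * A j i = (A * A).trace := fun A => by
        simp [Matrix.trace, Matrix.mul_apply]
      have h2 : h ^ 2 = (H * H.transpose).trace := by
        rw [frob_sq]
        simp [Matrix.trace, Matrix.mul_apply, sq]
      have hDt : D.transpose = D := hD
      rw [h1, h2, hH, hR]
      simp only [Matrix.transpose_mul, Matrix.transpose_transpose, hDt, Matrix.mul_assoc]
      rw [Matrix.trace_mul_comm]
      simp only [Matrix.mul_assoc]
    have hQD : m * frob (Q * D) ≤ S * h := by
      have h1 : frob (Q * D) ≤ S * frob (R * D) := by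
        conv_lhs => rw [hR, Matrix.mul_assoc]
        exact frob_mul_le hS0 hRtle
      calc m * frob (Q * D) ≤ m * (S * frob (R * D)) := by gcongr
        _ = S * (m * frob (R * D)) := by ring
        _ ≤ S * h := by
          gcongr
          exact mul_frob_le hm0.le hRge
    have hc1 : |∑ i, ∑ j, (Q * D) i j * E j i| ≤ e * h := by
      refine (abs_sum_mul_transpose_le _ _).trans ?_
      refine le_of_mul_le_mul_left (a := m) ?_ hm0
      calc m * (frob (Q * D) * F) = m * frob (Q * D) * F := by ring
        _ ≤ S * h * F := by gcongr
        _ = F * S * h := by ring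
        _ ≤ e * m * h := by gcongr
        _ = m * (e * h) := by ring
    have hc2 : |∑ i, ∑ j, E i j * E j i| ≤ e ^ 2 := by
      refine (abs_sum_mul_transpose_le _ _).trans ?_
      rw [sq]
      gcongr
    rw [sum_add_mul_add, htr]
    have := neg_le_of_abs_le hc1
    have := neg_le_of_abs_le hc2
    linarith
  · calc _ ≤ ‖w‖ * ‖act (Q * D + E) X‖ := abs_real_inner_le_norm _ _
      _ ≤ ‖w‖ * (S * ((h + e) * G)) := by gcongr
      _ = S * ‖w‖ * ((h + e) * G) := by ring
      _ ≤ T * ((h + e) * G) := by gcongr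
      _ = _ := by ring
  -- The only contribution quadratic in `h` is ⟨QDX, DX⟩. It has a favourable sign, so it can be
  -- dropped for every exponent instead of being absorbed.
  · have h1 : 0 ≤ inner ℝ (act D X) (act (Q * D) X) := by
      rw [act_mul, real_inner_comm]
      exact hpos _
    have h2 : |inner ℝ (act D X) (act E X)| ≤ h * e * G ^ 2 := by
      calc _ ≤ ‖act D X‖ * ‖act E X‖ := abs_real_inner_le_norm _ _
        _ ≤ ‖act D X‖ * (e * m * G) := by gcongr
        _ = m * ‖act D X‖ * (e * G) := by ring
        _ ≤ h * G * (e * G) := by gcongr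
        _ = _ := by ring
    have h3 : |inner ℝ (act E.transpose ξ) (act (Q * D + E) X)| ≤ (h * e + e ^ 2) * G ^ 2 := by
      calc _ ≤ ‖act E.transpose ξ‖ * ‖act (Q * D + E) X‖ := abs_real_inner_le_norm _ _
        _ ≤ ‖act E.transpose ξ‖ * (S * ((h + e) * G)) := by gcongr
        _ = S * ‖act E.transpose ξ‖ * ((h + e) * G) := by ring
        _ ≤ e * G * ((h + e) * G) := by gcongr
        _ = _ := by ring
    rw [inner_add_left, inner_smul_left, act_add, inner_add_right]
    rw [act_add] at h3
    have := neg_le_of_abs_le h2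
    have := neg_le_of_abs_le h3
    simp only [conj_trivial]
    linarith
  · calc _ ≤ ‖X‖ * ‖w‖ := abs_real_inner_le_norm _ _
      _ ≤ S * G * ‖w‖ := by gcongr
      _ = S * ‖w‖ * G := by ring
      _ ≤ T * G := by gcongr
  · have h1 : |inner ℝ X (act D X)| ≤ h * G ^ 2 := by
      have : inner ℝ X (act D X) = inner ℝ (act R ξ) (act R (act D X)) := by
        conv_lhs => rw [hX, inner_act_transpose]
        rw [← hX]
      rw [this]
      calc _ ≤ ‖act R ξ‖ * ‖act R (act D X)‖ := abs_real_inner_le_norm _ _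
        _ ≤ G * (h * G) := by rw [hGR]; gcongr
        _ = _ := by ring
    have h2 : |inner ℝ X (act E.transpose ξ)| ≤ e * G ^ 2 := by
      calc _ ≤ ‖X‖ * ‖act E.transpose ξ‖ := abs_real_inner_le_norm _ _
        _ ≤ S * G * ‖act E.transpose ξ‖ := by gcongr
        _ = S * ‖act E.transpose ξ‖ * G := by ring
        _ ≤ e * G * G := by gcongr
        _ = _ := by ring
    rw [inner_add_right, inner_smul_right]
    rw [abs_le] at *
    constructor <;> linarith [h1.1, h1.2, h2.1, h2.2]

end PointwiseBounds

/-! ### Real inequalities for the integrands when p > 2. -/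

section ScalarInequalities

/-- Applied to the integrand of the Bochner identity with r = √v, G = √E, s = vE + δ and Z =
s^{α-1}. The numbers `P₁`, …, `P₄` are the inner products produced by ∇W = αZ(E∇v + v∇E). Each of
their weighted contributions carries a factor b² = vE ≤ s, so the common weight sZ = W can be pulled
out. -/
lemma bernstein_integrand_lower {α g c r G b h A s Z t P₁ P₂ P₃ P₄ : ℝ} (hα : 0 ≤ α)
    (hg : 0 ≤ g) (hc : 0 ≤ c) (hr : 0 ≤ r) (hG : 0 ≤ G) (hb : b = r * G) (hh : 0 ≤ h)
    (hZ : 0 ≤ Z) (hbs : b ^ 2 ≤ s)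
    (ht : h ^ 2 - 2 * (c * b) * h - (c * b) ^ 2 ≤ t)
    (h₁ : |P₁| ≤ g * r ^ 3 * (h + c * b) * G)
    (h₂ : -((3 * h * (c * b) + (c * b) ^ 2) * G ^ 2) ≤ P₂)
    (h₃ : |P₃| ≤ g * r ^ 3 * G) (h₄ : |P₄| ≤ (2 * h + c * b) * G ^ 2) :
    s * Z * (h ^ 2 / 2 - ((2 * c + α * g + 3 * α * c) ^ 2 + 4 * α ^ 2 + (α * g + α * c) + c ^ 2 +
        α * g * c + α * c ^ 2 + 1) * (b ^ 2 + A ^ 2)) ≤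
      s * Z * t + α * Z * (G ^ 2 * P₁ + r ^ 2 * P₂) -
        α * Z * (G ^ 2 * P₃ + r ^ 2 * P₄) * A - s * Z * A ^ 2 := by
  have hb0 : 0 ≤ b := hb ▸ mul_nonneg hr hG
  have hcb : 0 ≤ c * b := mul_nonneg hc hb0
  have hs : 0 ≤ s := (sq_nonneg b).trans hbs
  have ha : 0 ≤ |A| := abs_nonneg A
  have q₁ : -(s * (g * b * (h + c * b))) ≤ G ^ 2 * P₁ := by
    have e₁ : -(g * r ^ 3 * (h + c * b) * G) ≤ P₁ := neg_le_of_abs_le h₁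
    calc -(s * (g * b * (h + c * b))) ≤ -(b ^ 2 * (g * b * (h + c * b))) := by gcongr
      _ = G ^ 2 * -(g * r ^ 3 * (h + c * b) * G) := by rw [hb]; ring
      _ ≤ _ := by gcongr
  have q₂ : -(s * (3 * h * (c * b) + (c * b) ^ 2)) ≤ r ^ 2 * P₂ := by
    calc -(s * (3 * h * (c * b) + (c * b) ^ 2)) ≤ -(b ^ 2 * (3 * h * (c * b) + (c * b) ^ 2)) := by
          gcongr
      _ = r ^ 2 * -((3 * h * (c * b) + (c * b) ^ 2) * G ^ 2) := by rw [hb]; ring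
      _ ≤ _ := by gcongr
  have q₃ : (G ^ 2 * P₃ + r ^ 2 * P₄) * A ≤ s * (g * b + (2 * h + c * b)) * |A| := by
    have e₃ : |G ^ 2 * P₃ + r ^ 2 * P₄| ≤ s * (g * b + (2 * h + c * b)) := by
      calc _ ≤ |G ^ 2 * P₃| + |r ^ 2 * P₄| := abs_add_le _ _
        _ = G ^ 2 * |P₃| + r ^ 2 * |P₄| := by
          rw [abs_mul, abs_mul, abs_of_nonneg (sq_nonneg G), abs_of_nonneg (sq_nonneg r)]
        _ ≤ G ^ 2 * (g * r ^ 3 * G) + r ^ 2 * ((2 * h + c * b) * G ^ 2) := by gcongr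
        _ = b ^ 2 * (g * b + (2 * h + c * b)) := by rw [hb]; ring
        _ ≤ _ := by gcongr
    calc _ ≤ |(G ^ 2 * P₃ + r ^ 2 * P₄) * A| := le_abs_self _
      _ = |G ^ 2 * P₃ + r ^ 2 * P₄| * |A| := abs_mul _ _
      _ ≤ _ := by gcongr
  have key : h ^ 2 / 2 - ((2 * c + α * g + 3 * α * c) ^ 2 + 4 * α ^ 2 + (α * g + α * c) + c ^ 2 +
      α * g * c + α * c ^ 2 + 1) * (b ^ 2 + A ^ 2) ≤
      (h ^ 2 - 2 * (c * b) * h - (c * b) ^ 2)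
        + α * (-(g * b * (h + c * b)) - (3 * h * (c * b) + (c * b) ^ 2))
        - α * ((g * b + (2 * h + c * b)) * |A|) - A ^ 2 := by
    rw [← sq_abs A]
    set a := |A|
    -- Each of the two squares spends a quarter of h², on the terms `h * b` and `h * a`
    -- respectively; half of h² survives.
    have i₁ := sq_nonneg (h / 2 - (2 * c + α * g + 3 * α * c) * b)
    have i₂ := sq_nonneg (h / 2 - 2 * α * a)
    have i₃ : 0 ≤ (α * g + α * c) * ((a - b) ^ 2 + a ^ 2 + b ^ 2) := by positivity
    have i₄ : 0 ≤ (c ^ 2 + α * g * c + α * c ^ 2) * a ^ 2 := by positivity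
    have i₅ : 0 ≤ ((2 * c + α * g + 3 * α * c) ^ 2) * a ^ 2 := by positivity
    have i₆ : 0 ≤ (4 * α ^ 2 + 1) * b ^ 2 := by positivity
    have i₇ : 0 ≤ h * b * (2 * c + α * g + 3 * α * c) := by positivity
    have i₈ : 0 ≤ α * a * h := by positivity
    linarith
  calc _ ≤ s * Z * ((h ^ 2 - 2 * (c * b) * h - (c * b) ^ 2)
        + α * (-(g * b * (h + c * b)) - (3 * h * (c * b) + (c * b) ^ 2))
        - α * ((g * b + (2 * h + c * b)) * |A|) - A ^ 2) := by gcongr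
    _ = s * Z * (h ^ 2 - 2 * (c * b) * h - (c * b) ^ 2)
        + α * Z * (-(s * (g * b * (h + c * b))) + -(s * (3 * h * (c * b) + (c * b) ^ 2)))
        - α * Z * (s * (g * b + (2 * h + c * b)) * |A|) - s * Z * A ^ 2 := by ring
    _ ≤ s * Z * t + α * Z * (G ^ 2 * P₁ + r ^ 2 * P₂) -
        α * Z * ((G ^ 2 * P₃ + r ^ 2 * P₄) * A) - s * Z * A ^ 2 := by gcongr
    _ = _ := by ring

/-- The counterpart for the test function u v W, in the same notation. The Hessian survives only in
a term linear in `h`, which the h²/2 gained from the Bochner identity can absorb. -/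
lemma energy_integrand_lower {α g c r G b h A s Z u P₃ P₄ : ℝ} (hα : 0 ≤ α)
    (hg : 0 ≤ g) (hc : 0 ≤ c) (hr : 0 ≤ r) (hG : 0 ≤ G) (hb : b = r * G) (hh : 0 ≤ h)
    (hZ : 0 ≤ Z) (hbs : b ^ 2 ≤ s)
    (h₃ : |P₃| ≤ g * r ^ 3 * G) (h₄ : |P₄| ≤ (2 * h + c * b) * G ^ 2) :
    s * Z * (b ^ 2 - r ^ 2 * |u| * |A| - (g + α * g + α * c) * (r ^ 2 * |u|) * b -
        2 * α * (r ^ 2 * |u|) * h) ≤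
      r ^ 2 * (s * Z) * G ^ 2 + u * r ^ 2 * (s * Z) * A + u * (s * Z) * P₃ +
        u * r ^ 2 * (α * Z * (G ^ 2 * P₃ + r ^ 2 * P₄)) := by
  have hb0 : 0 ≤ b := hb ▸ mul_nonneg hr hG
  have hcb : 0 ≤ c * b := mul_nonneg hc hb0
  have hs : 0 ≤ s := (sq_nonneg b).trans hbs
  have q₁ : -(r ^ 2 * |u| * |A|) ≤ u * r ^ 2 * A := by
    refine neg_le_of_abs_le (le_of_eq ?_)
    rw [abs_mul, abs_mul, abs_of_nonneg (sq_nonneg r)]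
    ring
  have q₂ : -(g * (r ^ 2 * |u|) * b) ≤ u * P₃ := by
    refine neg_le_of_abs_le ?_
    calc |u * P₃| = |u| * |P₃| := abs_mul _ _
      _ ≤ |u| * (g * r ^ 3 * G) := by gcongr
      _ = _ := by rw [hb]; ring
  have q₃ : -(s * (r ^ 2 * |u| * (g * b + (2 * h + c * b)))) ≤
      u * r ^ 2 * (G ^ 2 * P₃ + r ^ 2 * P₄) := by
    refine neg_le_of_abs_le ?_
    calc _ = |u| * r ^ 2 * |G ^ 2 * P₃ + r ^ 2 * P₄| := by
          rw [abs_mul, abs_mul, abs_of_nonneg (sq_nonneg r)]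
      _ ≤ |u| * r ^ 2 * (G ^ 2 * |P₃| + r ^ 2 * |P₄|) := by
          gcongr
          refine (abs_add_le _ _).trans_eq ?_
          rw [abs_mul, abs_mul, abs_of_nonneg (sq_nonneg G), abs_of_nonneg (sq_nonneg r)]
      _ ≤ |u| * r ^ 2 * (G ^ 2 * (g * r ^ 3 * G) + r ^ 2 * ((2 * h + c * b) * G ^ 2)) := by
          gcongr
      _ = b ^ 2 * (r ^ 2 * |u| * (g * b + (2 * h + c * b))) := by rw [hb]; ring
      _ ≤ _ := by gcongr
  calc _ = s * Z * b ^ 2 + s * Z * (-(r ^ 2 * |u| * |A|) + -(g * (r ^ 2 * |u|) * b)) +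
        α * Z * (-(s * (r ^ 2 * |u| * (g * b + (2 * h + c * b))))) := by ring
    _ ≤ s * Z * b ^ 2 + s * Z * (u * r ^ 2 * A + u * P₃) +
        α * Z * (u * r ^ 2 * (G ^ 2 * P₃ + r ^ 2 * P₄)) := by gcongr
    _ = _ := by rw [hb]; ring

/-- The quadratic inequality behind the absorption argument. -/
lemma exists_absorption (k α C₂ η : ℝ) (hC₂ : 0 < C₂) (hη : 0 < η) :
    ∃ l > 0, ∃ C > 0, ∀ b U a h : ℝ,
      b ^ 2 / 2 - η * a ^ 2 - C * U ^ 2 ≤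
        (b ^ 2 - U * a - k * U * b - 2 * α * U * h) +
          l * (h ^ 2 / 2 - C₂ * (b ^ 2 + a ^ 2)) := by
  -- The weight given to the Bochner identity: its errors cost at most b²/4 and η a²/2. The term in
  -- U h is then absorbed by l h²/2, at the price of a constant of order 1/l in front of U².
  set l := min (1 / (4 * C₂)) (η / (2 * C₂)) with hl
  have hl0 : 0 < l := lt_min (by positivity) (by positivity)
  have hl1 : l * C₂ ≤ 1 / 4 := by
    calc l * C₂ ≤ 1 / (4 * C₂) * C₂ := by gcongr; exact min_le_left _ _
      _ = 1 / 4 := by field_simp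
  have hl2 : l * C₂ ≤ η / 2 := by
    calc l * C₂ ≤ η / (2 * C₂) * C₂ := by gcongr; exact min_le_right _ _
      _ = η / 2 := by field_simp
  refine ⟨l, hl0, 1 / (2 * η) + k ^ 2 + 2 * α ^ 2 / l, by positivity, fun b U a h => ?_⟩
  have i₁ : U * a ≤ η / 2 * a ^ 2 + 1 / (2 * η) * U ^ 2 := by
    have : 0 ≤ (η * a - U) ^ 2 / (2 * η) := by positivity
    have e : (η * a - U) ^ 2 / (2 * η) = η / 2 * a ^ 2 + 1 / (2 * η) * U ^ 2 - U * a := by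
      field_simp
      ring
    linarith
  have i₂ : k * U * b ≤ b ^ 2 / 4 + k ^ 2 * U ^ 2 := by
    have := sq_nonneg (b / 2 - k * U)
    linarith
  have i₃ : 2 * α * U * h ≤ l * h ^ 2 / 2 + 2 * α ^ 2 / l * U ^ 2 := by
    have : 0 ≤ (l * h - 2 * α * U) ^ 2 / (2 * l) := by positivity
    have e : (l * h - 2 * α * U) ^ 2 / (2 * l)
        = l * h ^ 2 / 2 + 2 * α ^ 2 / l * U ^ 2 - 2 * α * U * h := by
      field_simp
      ring
    linarith
  have i₄ := mul_le_mul_of_nonneg_right hl1 (sq_nonneg b)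
  have i₅ := mul_le_mul_of_nonneg_right hl2 (sq_nonneg a)
  linarith

/-- Young's inequality `s^α a² ≤ s^{α+1} + |a|^{2α+2}`. -/
lemma rpow_mul_sq_le {α s a : ℝ} (hα : 0 ≤ α) (hs : 0 < s) :
    s ^ α * a ^ 2 ≤ s ^ α * s + |a| ^ (2 * α + 2) := by
  rcases le_total (a ^ 2) s with h | h
  · have : s ^ α * a ^ 2 ≤ s ^ α * s := by gcongr
    have : 0 ≤ |a| ^ (2 * α + 2) := by positivity
    linarith
  · have ha : 0 < |a| := by
      rw [abs_pos]
      rintro rfl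
      norm_num at h
      linarith
    have e : |a| ^ (2 * α + 2) = (a ^ 2) ^ α * a ^ 2 := by
      rw [Real.rpow_add ha, Real.rpow_mul ha.le, Real.rpow_two, sq_abs]
    have : s ^ α * a ^ 2 ≤ (a ^ 2) ^ α * a ^ 2 := by gcongr
    have : 0 ≤ s ^ α * s := by positivity
    linarith

/-- Young's inequality with a large constant. -/
lemma mul_rpow_mul_sq_le {α s U C : ℝ} (hα : 0 ≤ α) (hs : 0 < s) (hC : 0 < C) :
    C * (s ^ α * U ^ 2) ≤ s ^ α * s / 8 + (8 * C) ^ (α + 1) * |U| ^ (2 * α + 2) := by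
  have h := rpow_mul_sq_le (a := Real.sqrt (8 * C) * U) hα hs
  have e : |Real.sqrt (8 * C) * U| ^ (2 * α + 2)
      = (8 * C) ^ (α + 1) * |U| ^ (2 * α + 2) := by
    rw [abs_mul, Real.mul_rpow (abs_nonneg _) (abs_nonneg _), abs_of_nonneg (Real.sqrt_nonneg _),
      Real.sqrt_eq_rpow, ← Real.rpow_mul (by positivity)]
    congr 2
    ring
  rw [e, mul_pow, Real.sq_sqrt (by positivity)] at h
  have hX : 0 ≤ (8 * C) ^ (α + 1) * |U| ^ (2 * α + 2) := by positivity
  linarith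

end ScalarInequalities

/-! ### The flux Q∇u, its derivatives and the two integral identities. -/

section Flux

variable {d : ℕ}

local notation "𝔼" => EuclideanSpace ℝ (Fin d)
local notation "𝕄" => Matrix (Fin d) (Fin d) ℝ

/-- The gradient as the vector of the partial derivatives. -/
def grad (u : 𝔼 → ℝ) (x : 𝔼) : 𝔼 := WithLp.toLp 2 fun i => partialD i u x

@[simp] lemma grad_apply (u : 𝔼 → ℝ) (x : 𝔼) (i : Fin d) : grad u x i = partialD i u x := rfl

lemma gradient_eq_grad {u : 𝔼 → ℝ} {x : 𝔼} (hu : DifferentiableAt ℝ u x) :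
    gradient u x = grad u x := by
  ext i
  have h := (hu.hasGradientAt.hasFDerivAt).fderiv
  rw [grad_apply, partialD, h, InnerProductSpace.toDual_apply_apply]
  rw [EuclideanSpace.inner_single_right]
  simp only [conj_trivial, one_mul]

/-- The flux `(Q ∇u)_i`. -/
def flux (Q : 𝔼 → 𝕄) (u : 𝔼 → ℝ) (i : Fin d) (x : 𝔼) : ℝ := ∑ j, Q x i j * partialD j u x

/-- The scalar operator `div (Q ∇u)`. -/
def divFlux (Q : 𝔼 → 𝕄) (u : 𝔼 → ℝ) (x : 𝔼) : ℝ := ∑ i, partialD i (flux Q u i) x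

/-- The Hessian matrix. -/
def hess (u : 𝔼 → ℝ) (x : 𝔼) : 𝕄 := Matrix.of fun i j => partialD i (partialD j u) x

/-- The matrix `(∑_j D_k q_{ij} D_j u)_{ik}`, the part of `∇(Q∇u)` in which the coefficients are
differentiated. -/
def coeffGrad (Q : 𝔼 → 𝕄) (u : 𝔼 → ℝ) (x : 𝔼) : 𝕄 :=
  Matrix.of fun i k => ∑ j, partialD k (fun y => Q y i j) x * partialD j u x

lemma act_grad_apply (Q : 𝔼 → 𝕄) (u : 𝔼 → ℝ) (x : 𝔼) (i : Fin d) :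
    act (Q x) (grad u x) i = flux Q u i x := by
  simp [act_apply, flux]

/-- The energy density `⟨Q ∇u, ∇u⟩`. -/
def energy (Q : 𝔼 → 𝕄) (u : 𝔼 → ℝ) (x : 𝔼) : ℝ := quad (Q x) (grad u x)

lemma energy_eq_sum (Q : 𝔼 → 𝕄) (u : 𝔼 → ℝ) (x : 𝔼) :
    energy Q u x = ∑ i, flux Q u i x * partialD i u x := by
  simp [energy, quad_eq_sum, flux]

variable {Q : EuclideanSpace ℝ (Fin d) → Matrix (Fin d) (Fin d) ℝ}
  {u : EuclideanSpace ℝ (Fin d) → ℝ}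

lemma contDiff_flux (hQ : ∀ i j, ContDiff ℝ 1 fun x => Q x i j) (hu : ContDiff ℝ 2 u)
    (i : Fin d) : ContDiff ℝ 1 (flux Q u i) :=
  ContDiff.sum fun j _ => (hQ i j).mul (hu.partialD (by norm_num) j)

lemma contDiff_energy (hQ : ∀ i j, ContDiff ℝ 1 fun x => Q x i j) (hu : ContDiff ℝ 2 u) :
    ContDiff ℝ 1 (energy Q u) := by
  rw [funext (energy_eq_sum Q u)]
  exact ContDiff.sum fun i _ => (contDiff_flux hQ hu i).mul (hu.partialD (by norm_num) i)

lemma continuous_divFlux (hQ : ∀ i j, ContDiff ℝ 1 fun x => Q x i j) (hu : ContDiff ℝ 2 u) :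
    Continuous (divFlux Q u) :=
  continuous_finsetSum _ fun i _ => continuous_partialD (contDiff_flux hQ hu i) i

lemma partialD_eq_zero {x : 𝔼} (hx : x ∉ tsupport u) (i : Fin d) : partialD i u x = 0 :=
  image_eq_zero_of_notMem_tsupport fun h => hx (tsupport_partialD_subset u i h)

lemma flux_eq_zero {x : 𝔼} (hx : x ∉ tsupport u) (i : Fin d) : flux Q u i x = 0 := by
  simp [flux, partialD_eq_zero hx]

lemma hasCompactSupport_flux (hc : HasCompactSupport u) (i : Fin d) :
    HasCompactSupport (flux Q u i) :=
  HasCompactSupport.intro hc fun _ hx => flux_eq_zero hx i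

lemma tsupport_flux_subset (i : Fin d) : tsupport (flux Q u i) ⊆ tsupport u :=
  closure_minimal (fun x hx => by
    by_contra h
    exact hx (flux_eq_zero h i)) (isClosed_tsupport u)

lemma divFlux_eq_zero {x : 𝔼} (hx : x ∉ tsupport u) : divFlux Q u x = 0 :=
  Finset.sum_eq_zero fun i _ => partialD_eq_zero (fun h => hx (tsupport_flux_subset i h)) i

lemma energy_eq_zero {x : 𝔼} (hx : x ∉ tsupport u) : energy Q u x = 0 := by
  simp [energy_eq_sum, flux_eq_zero hx]

lemma partialD_flux (hQ : ∀ i j, ContDiff ℝ 1 fun x => Q x i j) (hu : ContDiff ℝ 2 u)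
    (i k : Fin d) (x : 𝔼) :
    partialD k (flux Q u i) x = (Q x * hess u x + coeffGrad Q u x) i k := by
  have h1 : ∀ j, DifferentiableAt ℝ (fun y => Q y i j) x := fun j =>
    (hQ i j).differentiable one_ne_zero x
  have h2 : ∀ j, DifferentiableAt ℝ (partialD j u) x := fun j =>
    (hu.partialD (k := 1) (by norm_num) j).differentiable one_ne_zero x
  have h : partialD k (flux Q u i) x = ∑ j, (partialD k (fun y => Q y i j) x * partialD j u x
      + Q x i j * partialD k (partialD j u) x) := by
    refine (partialD_sum k fun j _ => (h1 j).fun_mul (h2 j)).trans ?_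
    exact Finset.sum_congr rfl fun j _ => partialD_mul k (h1 j) (h2 j)
  rw [h, Finset.sum_add_distrib, add_comm]
  simp [Matrix.mul_apply, hess, coeffGrad, partialD_comm hu k]

lemma isSymm_hess (hu : ContDiff ℝ 2 u) (x : 𝔼) : (hess u x).IsSymm :=
  Matrix.IsSymm.ext fun i j => partialD_comm hu j i x

/-- Differentiating ⟨X, ∇u⟩ gives DX once from ∇u and, by the symmetry of `Q` and `D`, once more
from X; what remains comes from the coefficients. -/
lemma partialD_energy (hQs : ∀ x, (Q x).IsSymm) (hQ : ∀ i j, ContDiff ℝ 1 fun x => Q x i j)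
    (hu : ContDiff ℝ 2 u) (k : Fin d) (x : 𝔼) :
    partialD k (energy Q u) x = ((2 : ℝ) • act (hess u x) (act (Q x) (grad u x)) +
      act (coeffGrad Q u x).transpose (grad u x)) k := by
  have h1 : ∀ j, DifferentiableAt ℝ (flux Q u j) x := fun j =>
    (contDiff_flux hQ hu j).differentiable one_ne_zero x
  have h2 : ∀ j, DifferentiableAt ℝ (partialD j u) x := fun j =>
    (hu.partialD (k := 1) (by norm_num) j).differentiable one_ne_zero x
  have h : partialD k (energy Q u) x = ∑ i, (partialD k (flux Q u i) x * partialD i u x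
      + flux Q u i x * partialD k (partialD i u) x) := by
    rw [funext (energy_eq_sum Q u)]
    refine (partialD_sum k fun i _ => (h1 i).fun_mul (h2 i)).trans ?_
    exact Finset.sum_congr rfl fun i _ => partialD_mul k (h1 i) (h2 i)
  have h3 : ∑ i, (Q x * hess u x) i k * partialD i u x
      = ∑ i, flux Q u i x * partialD k (partialD i u) x := by
    simp only [Matrix.mul_apply, flux, Finset.sum_mul, hess, Matrix.of_apply]
    rw [Finset.sum_comm]
    refine Finset.sum_congr rfl fun j _ => Finset.sum_congr rfl fun i _ => ?_
    rw [(hQs x).apply j i, partialD_comm hu k j]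
    ring
  have h4 : act (hess u x) (act (Q x) (grad u x)) k
      = ∑ i, flux Q u i x * partialD k (partialD i u) x := by
    rw [act_apply]
    simp only [act_grad_apply, hess, Matrix.of_apply, mul_comm]
  have h5 : act (coeffGrad Q u x).transpose (grad u x) k
      = ∑ i, coeffGrad Q u x i k * partialD i u x := by
    rw [act_apply]
    simp
  rw [h, Finset.sum_add_distrib, PiLp.add_apply, PiLp.smul_apply, h4, h5]
  simp only [partialD_flux hQ hu, Matrix.add_apply, add_mul, Finset.sum_add_distrib, h3,
    smul_eq_mul]
  ring

lemma frob_coeffGrad_le (x : 𝔼) : frob (coeffGrad Q u x) ≤ gradNorm Q x * ‖grad u x‖ := by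
  refine le_of_sq_le_sq ?_ (mul_nonneg (Real.sqrt_nonneg _) (norm_nonneg _))
  rw [mul_pow, gradNorm, Real.sq_sqrt (by positivity), frob_sq, Finset.sum_comm, Finset.sum_mul]
  refine Finset.sum_le_sum fun k _ => ?_
  rw [Finset.sum_mul]
  refine Finset.sum_le_sum fun i _ => ?_
  rw [norm_sq_eq_sum]
  simp only [coeffGrad, Matrix.of_apply, grad_apply]
  exact Finset.sum_mul_sq_le_sq_mul_sq _ _ _

/-- Integration by parts against a scalar weight. -/
lemma integral_weighted_energy {φ : 𝔼 → ℝ} (hQ : ∀ i j, ContDiff ℝ 1 fun x => Q x i j)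
    (hu : ContDiff ℝ 2 u) (hc : HasCompactSupport u) (hφ : ContDiff ℝ 1 φ) :
    Integrable (fun x => inner ℝ (act (Q x) (grad u x)) (grad φ x) + φ x * divFlux Q u x) ∧
    ∫ x, (inner ℝ (act (Q x) (grad u x)) (grad φ x) + φ x * divFlux Q u x) = 0 := by
  have hd : ∀ i, ContDiff ℝ 1 fun y => φ y * flux Q u i y := fun i =>
    hφ.mul (contDiff_flux hQ hu i)
  have hcs : ∀ i, HasCompactSupport fun y => φ y * flux Q u i y := fun i =>
    (hasCompactSupport_flux hc i).mul_left
  have e : ∀ x, inner ℝ (act (Q x) (grad u x)) (grad φ x) + φ x * divFlux Q u x =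
      ∑ i, partialD i (fun y => φ y * flux Q u i y) x := by
    intro x
    rw [inner_eq_sum, divFlux, Finset.mul_sum, ← Finset.sum_add_distrib]
    refine Finset.sum_congr rfl fun i _ => ?_
    rw [partialD_mul i (hφ.differentiable one_ne_zero x)
      ((contDiff_flux hQ hu i).differentiable one_ne_zero x), act_grad_apply, grad_apply]
    ring
  have hint : ∀ i, Integrable (partialD i fun y => φ y * flux Q u i y) := fun i =>
    (continuous_partialD (hd i) i).integrable_of_hasCompactSupport ((hcs i).partialD i)
  simp only [e]
  refine ⟨integrable_finsetSum _ fun i _ => hint i, ?_⟩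
  rw [integral_finsetSum _ fun i _ => hint i]
  exact Finset.sum_eq_zero fun i _ => integral_partialD_eq_zero (hd i) (hcs i) i

/-- The integrated Bochner identity for the flux `Q∇u` with a weight `W`. -/
lemma integral_weighted_hessian {W : 𝔼 → ℝ} (hQ : ∀ i j, ContDiff ℝ 1 fun x => Q x i j)
    (hu : ContDiff ℝ 2 u) (hc : HasCompactSupport u) (hW : ContDiff ℝ 1 W) :
    Integrable (fun x =>
      W x * (∑ i, ∑ j, (Q x * hess u x + coeffGrad Q u x) i j *
        (Q x * hess u x + coeffGrad Q u x) j i) +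
      inner ℝ (grad W x) (act (Q x * hess u x + coeffGrad Q u x) (act (Q x) (grad u x))) -
      inner ℝ (act (Q x) (grad u x)) (grad W x) * divFlux Q u x - W x * divFlux Q u x ^ 2) ∧
    ∫ x, (W x * (∑ i, ∑ j, (Q x * hess u x + coeffGrad Q u x) i j *
        (Q x * hess u x + coeffGrad Q u x) j i) +
      inner ℝ (grad W x) (act (Q x * hess u x + coeffGrad Q u x) (act (Q x) (grad u x))) -
      inner ℝ (act (Q x) (grad u x)) (grad W x) * divFlux Q u x - W x * divFlux Q u x ^ 2) = 0 := by
  have hX := contDiff_flux hQ hu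
  have hXc : ∀ i, HasCompactSupport (flux Q u i) := hasCompactSupport_flux hc
  have hd : ∀ i, ContDiff ℝ 1 fun y => W y * flux Q u i y := fun i => hW.mul (hX i)
  have hcs : ∀ i, HasCompactSupport fun y => W y * flux Q u i y := fun i => (hXc i).mul_left
  -- With X the flux, the integrand is the sum over i, k of D_k(W X_i) D_i X_k - D_i(W X_i) D_k X_k.
  -- Each summand integrates to zero by exchanging derivatives, although X is only of class C¹.
  have e : ∀ x, W x * (∑ i, ∑ j, (Q x * hess u x + coeffGrad Q u x) i j *
        (Q x * hess u x + coeffGrad Q u x) j i) +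
      inner ℝ (grad W x) (act (Q x * hess u x + coeffGrad Q u x) (act (Q x) (grad u x))) -
      inner ℝ (act (Q x) (grad u x)) (grad W x) * divFlux Q u x - W x * divFlux Q u x ^ 2 =
      ∑ i, ∑ k, (partialD k (fun y => W y * flux Q u i y) x * partialD i (flux Q u k) x -
        partialD i (fun y => W y * flux Q u i y) x * partialD k (flux Q u k) x) := by
    intro x
    have h1 : ∀ i k, partialD k (fun y => W y * flux Q u i y) x =
        partialD k W x * flux Q u i x + W x * partialD k (flux Q u i) x := fun i k =>
      partialD_mul k (hW.differentiable one_ne_zero x) ((hX i).differentiable one_ne_zero x)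
    have h2 : inner ℝ (act (Q x) (grad u x)) (grad W x) * divFlux Q u x + W x * divFlux Q u x ^ 2 =
        ∑ i, ∑ k, partialD i (fun y => W y * flux Q u i y) x * partialD k (flux Q u k) x := by
      rw [← Finset.sum_mul_sum]
      simp only [h1, Finset.sum_add_distrib, ← Finset.mul_sum]
      rw [inner_eq_sum]
      simp only [act_grad_apply, grad_apply, divFlux, mul_comm (flux Q u _ x)]
      ring
    have h3 : W x * (∑ i, ∑ j, (Q x * hess u x + coeffGrad Q u x) i j *
        (Q x * hess u x + coeffGrad Q u x) j i) +
      inner ℝ (grad W x) (act (Q x * hess u x + coeffGrad Q u x) (act (Q x) (grad u x))) =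
        ∑ i, ∑ k, partialD k (fun y => W y * flux Q u i y) x * partialD i (flux Q u k) x := by
      simp only [h1, partialD_flux hQ hu, add_mul, Finset.sum_add_distrib]
      rw [add_comm, Finset.sum_comm (f := fun i k => partialD k W x * _ * _), inner_eq_sum]
      simp only [act_apply _ (act (Q x) (grad u x)), act_grad_apply, grad_apply, Finset.mul_sum]
      congr 1
      · refine Finset.sum_congr rfl fun i _ => Finset.sum_congr rfl fun j _ => by ring
      · refine Finset.sum_congr rfl fun i _ => Finset.sum_congr rfl fun j _ => by ring
    simp only [Finset.sum_sub_distrib]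
    rw [← h2, ← h3]
    ring
  have hint : ∀ i j k l, Integrable fun x =>
      partialD k (fun y => W y * flux Q u i y) x * partialD l (flux Q u j) x := fun i j k l =>
    ((continuous_partialD (hd i) k).mul
      (continuous_partialD (hX j) l)).integrable_of_hasCompactSupport
      (((hXc j).partialD l).mul_left)
  have hint' : ∀ i k, Integrable fun x =>
      partialD k (fun y => W y * flux Q u i y) x * partialD i (flux Q u k) x -
        partialD i (fun y => W y * flux Q u i y) x * partialD k (flux Q u k) x := fun i k =>
    (hint _ _ _ _).sub (hint _ _ _ _)
  simp only [e]
  refine ⟨integrable_finsetSum _ fun i _ => integrable_finsetSum _ fun k _ => hint' i k, ?_⟩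
  rw [integral_finsetSum _ fun i _ => integrable_finsetSum _ fun k _ => hint' i k]
  refine Finset.sum_eq_zero fun i _ => ?_
  rw [integral_finsetSum _ fun k _ => hint' i k]
  refine Finset.sum_eq_zero fun k _ => ?_
  rw [integral_sub (hint _ _ _ _) (hint _ _ _ _), sub_eq_zero]
  exact integral_partialD_mul_partialD_comm (hd i) (hX k) (hcs i) (hXc k) i k

end Flux

/-! ### The case p > 2: the weighted inequality. -/

section LargeExponent

/-- The qualitative assumptions on the diffusion matrix and on the auxiliary potential. -/
structure RegularCoeff {d : ℕ} (Q : EuclideanSpace ℝ (Fin d) → Matrix (Fin d) (Fin d) ℝ)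
    (v : EuclideanSpace ℝ (Fin d) → ℝ) : Prop where
  symm : ∀ x, (Q x).IsSymm
  smooth : ∀ i j, ContDiff ℝ 1 fun x => Q x i j
  pos : ∀ x ξ, ξ ≠ 0 → 0 < quad (Q x) ξ
  smooth_v : ContDiff ℝ 1 v
  pos_v : ∀ x, 0 < v x

variable {d : ℕ}

local notation "𝔼" => EuclideanSpace ℝ (Fin d)
local notation "𝕄" => Matrix (Fin d) (Fin d) ℝ

lemma RegularCoeff.quad_nonneg {Q : 𝔼 → 𝕄} {v : 𝔼 → ℝ} (hQ : RegularCoeff Q v) (x ξ : 𝔼) :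
    0 ≤ quad (Q x) ξ := by
  by_cases h : ξ = 0
  · simp [h, quad]
  · exact (hQ.pos x ξ h).le

lemma RegularCoeff.energy_nonneg {Q : 𝔼 → 𝕄} {v : 𝔼 → ℝ} (hQ : RegularCoeff Q v) (u : 𝔼 → ℝ)
    (x : 𝔼) : 0 ≤ energy Q u x :=
  hQ.quad_nonneg x _

lemma grad_mul {f g : 𝔼 → ℝ} {x : 𝔼} (hf : DifferentiableAt ℝ f x)
    (hg : DifferentiableAt ℝ g x) :
    grad (fun y => f y * g y) x = g x • grad f x + f x • grad g x := by
  ext i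
  simp only [grad_apply, partialD_mul i hf hg, PiLp.add_apply, PiLp.smul_apply, smul_eq_mul]
  ring

lemma grad_comp {φ : ℝ → ℝ} {f : 𝔼 → ℝ} {x : 𝔼} {φ' : ℝ} (hφ : HasDerivAt φ φ' (f x))
    (hf : DifferentiableAt ℝ f x) : grad (fun y => φ (f y)) x = φ' • grad f x := by
  ext i
  simp only [grad_apply, partialD_comp i hφ hf, PiLp.smul_apply, smul_eq_mul]

lemma grad_add_const {f : 𝔼 → ℝ} {x : 𝔼} (c : ℝ) :
    grad (fun y => f y + c) x = grad f x := by
  ext i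
  simp only [grad_apply, partialD_add_const]

lemma grad_energy {Q : 𝔼 → 𝕄} {u : 𝔼 → ℝ} (hQs : ∀ x, (Q x).IsSymm)
    (hQ : ∀ i j, ContDiff ℝ 1 fun x => Q x i j) (hu : ContDiff ℝ 2 u) (x : 𝔼) :
    grad (energy Q u) x = (2 : ℝ) • act (hess u x) (act (Q x) (grad u x)) +
      act (coeffGrad Q u x).transpose (grad u x) := by
  ext i
  rw [grad_apply, partialD_energy hQs hQ hu]

/-- The integrand lies pointwise below that of the energy identity tested with u v W plus `l` times
that of the Bochner identity with weight W, and both identities integrate to zero. The constant is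
fixed before δ, so that δ may tend to 0; a positive δ keeps W of class C¹ where ∇u vanishes. -/
lemma exists_integral_weighted_le_zero (α g c : ℝ) {η : ℝ} (hα : 0 ≤ α) (hg : 0 ≤ g)
    (hc : 0 ≤ c) (hη : 0 < η) :
    ∃ C > 0, ∀ (d : ℕ), 0 < d → ∀ (Q : EuclideanSpace ℝ (Fin d) → Matrix (Fin d) (Fin d) ℝ)
      (v u : EuclideanSpace ℝ (Fin d) → ℝ), RegularCoeff Q v →
      (∀ x, gradNorm Q x * Real.sqrt ‖act (Q x)‖ ≤ c * Real.sqrt (v x) * minEigenvalue (Q x)) →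
      (∀ x, Real.sqrt ‖act (Q x)‖ * ‖grad v x‖ ≤ g * Real.sqrt (v x) ^ 3) →
      ContDiff ℝ 2 u → HasCompactSupport u → ∀ δ > 0,
      Integrable (fun x => (v x * energy Q u x + δ) ^ α *
        (v x * energy Q u x / 2 - η * divFlux Q u x ^ 2 - C * (v x * u x) ^ 2)) ∧
      ∫ x, (v x * energy Q u x + δ) ^ α *
        (v x * energy Q u x / 2 - η * divFlux Q u x ^ 2 - C * (v x * u x) ^ 2) ≤ 0 := by
  have hC₂ : 0 < (2 * c + α * g + 3 * α * c) ^ 2 + 4 * α ^ 2 + (α * g + α * c) + c ^ 2 +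
        α * g * c + α * c ^ 2 + 1 := by positivity
  obtain ⟨l, hl, C, hC, habs⟩ := exists_absorption (g + α * g + α * c) α _ η hC₂ hη
  refine ⟨C, hC, fun d hd Q v u hQ hN hw hu hsupp δ hδ => ?_⟩
  have hE := contDiff_energy hQ.smooth hu
  have hu1 : ContDiff ℝ 1 u := hu.of_le (by norm_num)
  have hs0 : ∀ x, 0 < v x * energy Q u x + δ := fun x =>
    add_pos_of_nonneg_of_pos (mul_nonneg (hQ.pos_v x).le (hQ.energy_nonneg u x)) hδ
  set W : EuclideanSpace ℝ (Fin d) → ℝ := fun x => (v x * energy Q u x + δ) ^ α with hW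
  have hsC : ContDiff ℝ 1 fun x => v x * energy Q u x + δ :=
    (hQ.smooth_v.mul hE).add contDiff_const
  have hWC : ContDiff ℝ 1 W := hsC.rpow_const_of_ne fun x => (hs0 x).ne'
  have hφC : ContDiff ℝ 1 fun x => u x * (v x * W x) := hu1.mul (hQ.smooth_v.mul hWC)
  have hint : Integrable fun x => W x *
      (v x * energy Q u x / 2 - η * divFlux Q u x ^ 2 - C * (v x * u x) ^ 2) := by
    refine Continuous.integrable_of_hasCompactSupport ?_ ?_
    · have h1 := hWC.continuous
      have h2 := hQ.smooth_v.continuous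
      have h3 := hE.continuous
      have h4 := continuous_divFlux hQ.smooth hu
      have h5 := hu.continuous
      fun_prop
    · refine HasCompactSupport.intro hsupp fun x hx => ?_
      simp [energy_eq_zero hx, divFlux_eq_zero hx, image_eq_zero_of_notMem_tsupport hx]
  refine ⟨hint, ?_⟩
  obtain ⟨i₁, e₁⟩ := integral_weighted_energy hQ.smooth hu hsupp hφC
  obtain ⟨i₂, e₂⟩ := integral_weighted_hessian hQ.smooth hu hsupp hWC
  have e₃ := integral_add i₁ (i₂.const_mul l)
  rw [integral_const_mul, e₁, e₂, mul_zero, add_zero] at e₃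
  rw [← e₃]
  refine integral_mono hint (i₁.add (i₂.const_mul l)) fun x => ?_
  simp only
  have dv : DifferentiableAt ℝ v x := hQ.smooth_v.differentiable one_ne_zero x
  have dE : DifferentiableAt ℝ (energy Q u) x := hE.differentiable one_ne_zero x
  have dW : DifferentiableAt ℝ W x := hWC.differentiable one_ne_zero x
  set s := v x * energy Q u x + δ with hs
  have hgW : grad W x = (α * s ^ (α - 1)) • (energy Q u x • grad v x + v x •
      ((2 : ℝ) • act (hess u x) (act (Q x) (grad u x)) +
        act (coeffGrad Q u x).transpose (grad u x))) := by
    rw [hW, grad_comp (φ := fun t => t ^ α) (Real.hasDerivAt_rpow_const (Or.inl (hs0 x).ne'))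
      (hsC.differentiable one_ne_zero x), grad_add_const, grad_mul dv dE,
      grad_energy hQ.symm hQ.smooth hu]
  have hgφ : grad (fun y => u y * (v y * W y)) x = (v x * W x) • grad u x +
      u x • (W x • grad v x + v x • grad W x) := by
    rw [grad_mul (hu1.differentiable one_ne_zero x) (dv.fun_mul dW), grad_mul dv dW]
  set r := Real.sqrt (v x) with hr
  have hr0 : 0 ≤ r := Real.sqrt_nonneg _
  have hr2 : v x = r ^ 2 := (Real.sq_sqrt (hQ.pos_v x).le).symm
  set G := Real.sqrt (energy Q u x) with hG
  have hG0 : 0 ≤ G := Real.sqrt_nonneg _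
  have hG2 : energy Q u x = G ^ 2 := (Real.sq_sqrt (hQ.energy_nonneg u x)).symm
  obtain ⟨h, hh0, k₁, k₂, k₃, k₄, k₅⟩ := exists_hessian_bounds (hQ.symm x) (isSymm_hess hu x)
    (minEigenvalue_pos hd (hQ.symm x) (hQ.pos x)) (minEigenvalue_mul_le_quad (hQ.symm x)) hd
    (show G = Real.sqrt (quad (Q x) (grad u x)) from rfl) (mul_nonneg hc hr0)
    (show c * (r * G) = c * r * G by ring) (frob_coeffGrad_le x) (hN x) (hw x)
  have hZ : 0 ≤ s ^ (α - 1) := (Real.rpow_pos_of_pos (hs0 x) _).le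
  have hsα : s ^ α = s * s ^ (α - 1) := by
    rw [Real.rpow_sub_one (hs0 x).ne', mul_div_cancel₀ _ (hs0 x).ne']
  have hWs : W x = s * s ^ (α - 1) := hsα
  have hbs : (r * G) ^ 2 ≤ s := by
    rw [hs, hr2, hG2, mul_pow]
    linarith
  have B₂ := bernstein_integrand_lower (A := divFlux Q u x) hα hg hc hr0 hG0 rfl hh0 hZ hbs
    k₁ k₂ k₃ k₄ k₅
  have B₁ := energy_integrand_lower (A := divFlux Q u x) (u := u x) hα hg hc hr0 hG0 rfl hh0 hZ
    hbs k₄ k₅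
  have key := habs (r * G) (r ^ 2 * |u x|) |divFlux Q u x| h
  rw [sq_abs] at key
  have hW0 : 0 ≤ W x := (Real.rpow_pos_of_pos (hs0 x) _).le
  have E₁ : inner ℝ (act (Q x) (grad u x)) (grad (fun y => u y * (v y * W y)) x) =
      r ^ 2 * W x * G ^ 2 + u x * W x * inner ℝ (act (Q x) (grad u x)) (grad v x) +
        u x * r ^ 2 * inner ℝ (act (Q x) (grad u x)) (grad W x) := by
    rw [hgφ, inner_add_right, inner_smul_right, inner_smul_right, inner_add_right,
      inner_smul_right, inner_smul_right,
      show inner ℝ (act (Q x) (grad u x)) (grad u x) = G ^ 2 from hG2, hr2]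
    ring
  have E₂ : inner ℝ (act (Q x) (grad u x)) (grad W x) = α * s ^ (α - 1) *
      (G ^ 2 * inner ℝ (act (Q x) (grad u x)) (grad v x) + r ^ 2 * inner ℝ (act (Q x) (grad u x))
        ((2 : ℝ) • act (hess u x) (act (Q x) (grad u x)) +
        act (coeffGrad Q u x).transpose (grad u x))) := by
    rw [hgW, inner_smul_right, inner_add_right, inner_smul_right, inner_smul_right, hG2, hr2]
  have E₃ : inner ℝ (grad W x)
      (act (Q x * hess u x + coeffGrad Q u x) (act (Q x) (grad u x))) = α * s ^ (α - 1) *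
      (G ^ 2 * inner ℝ (grad v x)
        (act (Q x * hess u x + coeffGrad Q u x) (act (Q x) (grad u x))) +
      r ^ 2 * inner ℝ ((2 : ℝ) • act (hess u x) (act (Q x) (grad u x)) +
        act (coeffGrad Q u x).transpose (grad u x))
        (act (Q x * hess u x + coeffGrad Q u x) (act (Q x) (grad u x)))) := by
    rw [hgW, real_inner_smul_left, inner_add_left, real_inner_smul_left, real_inner_smul_left,
      hG2, hr2]
  rw [E₁, E₃, E₂, hG2, hr2, hWs, hsα]
  rw [hWs] at hW0
  have key' := mul_le_mul_of_nonneg_left key hW0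
  have B₂' := mul_le_mul_of_nonneg_left B₂ hl.le
  have hU : (r ^ 2 * |u x|) ^ 2 = (r ^ 2 * u x) ^ 2 := by rw [mul_pow, sq_abs, mul_pow]
  rw [hU] at key'
  linarith

end LargeExponent

/-! ### The case p > 2: from the weighted inequality to p-th powers. -/

section LargeExponentIntegral

lemma le_of_forall_small_le_add_mul {X Y M : ℝ} (hM : 0 ≤ M)
    (h : ∀ t : ℝ, 0 < t → t ≤ 1 → X ≤ Y + t * M) : X ≤ Y := by
  refine le_of_forall_pos_le_add fun e he => ?_
  refine (h (min 1 (e / (M + 1))) (lt_min one_pos (by positivity)) (min_le_left _ _)).trans ?_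
  gcongr
  calc min 1 (e / (M + 1)) * M ≤ e / (M + 1) * M := by gcongr; exact min_le_right _ _
    _ ≤ e / (M + 1) * (M + 1) := by gcongr; linarith
    _ = e := by field_simp

/-- With s = y + δ, Young's inequality charges s^{α+1}/8 to each of the terms in A and U, leaving
1/4 of the initial 1/2. The last term on the left pays for replacing `y` by s. -/
lemma weighted_integrand_lower {α η C δ y A U : ℝ} (hα : 0 ≤ α) (hη : 0 < η) (hη' : η ≤ 1 / 8)
    (hC : 0 < C) (hδ : 0 < δ) (hy : 0 ≤ y) :
    y ^ (α + 1) / 4 - η * |A| ^ (2 * α + 2) - (8 * C) ^ (α + 1) * |U| ^ (2 * α + 2) -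
      δ * (y + δ) ^ α ≤ (y + δ) ^ α * (y / 2 - η * A ^ 2 - C * U ^ 2) := by
  have hs : 0 < y + δ := by positivity
  set s := y + δ with hsdef
  have h1 := rpow_mul_sq_le (a := A) hα hs
  have h2 := mul_rpow_mul_sq_le (U := U) hα hs hC
  have h3 : y ^ (α + 1) ≤ s ^ α * s := by
    rw [← Real.rpow_add_one hs.ne']
    exact Real.rpow_le_rpow hy (by linarith) (by linarith)
  have h4 : η * (s ^ α * A ^ 2) ≤ s ^ α * s / 8 + η * |A| ^ (2 * α + 2) := by
    have h5 : η * (s ^ α * A ^ 2) ≤ η * (s ^ α * s) + η * |A| ^ (2 * α + 2) := by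
      rw [← mul_add]
      gcongr
    have h6 : η * (s ^ α * s) ≤ 1 / 8 * (s ^ α * s) := by gcongr
    linarith
  have h7 : s ^ α * y = s ^ α * s - δ * s ^ α := by rw [hsdef]; ring
  have h8 : 0 ≤ δ * s ^ α := by positivity
  linarith

lemma integrable_abs_rpow {d : ℕ} {f : EuclideanSpace ℝ (Fin d) → ℝ} {p : ℝ} (hp : 0 < p)
    (hf : Continuous f) {K : Set (EuclideanSpace ℝ (Fin d))} (hK : IsCompact K)
    (hs : ∀ x, x ∉ K → f x = 0) : Integrable fun x => |f x| ^ p := by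
  refine Continuous.integrable_of_hasCompactSupport ?_ (HasCompactSupport.intro hK fun x hx => ?_)
  · exact hf.abs.rpow_const fun _ => Or.inr hp.le
  · simp [hs x hx, Real.zero_rpow hp.ne']

lemma mul_integral_le_of_combination_le {X : Type*} [MeasurableSpace X] {ν : Measure X}
    {f g h k F : X → ℝ} (a b c e : ℝ) (hf : Integrable f ν) (hg : Integrable g ν)
    (hh : Integrable h ν) (hk : Integrable k ν) (hF : Integrable F ν)
    (hle : ∀ x, a * f x ≤ b * g x + c * h x + e * k x + F x) (h0 : ∫ x, F x ∂ν ≤ 0) :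
    a * ∫ x, f x ∂ν ≤ b * ∫ x, g x ∂ν + c * ∫ x, h x ∂ν + e * ∫ x, k x ∂ν := by
  have i₁ : Integrable (fun x => b * g x + c * h x) ν := (hg.const_mul b).add (hh.const_mul c)
  have i₂ : Integrable (fun x => b * g x + c * h x + e * k x) ν := i₁.add (hk.const_mul e)
  have hm := integral_mono (hf.const_mul a) (i₂.add hF) hle
  rw [integral_const_mul, integral_add' i₂ hF, integral_add i₁ (hk.const_mul e),
    integral_add (hg.const_mul b) (hh.const_mul c), integral_const_mul, integral_const_mul,
    integral_const_mul] at hm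
  linarith

theorem exists_integral_energy_le_of_two_lt {p : ℝ} (hp : 2 < p) (g c : ℝ) {ε : ℝ} (hg : 0 ≤ g)
    (hc : 0 ≤ c) (hε : 0 < ε) :
    ∃ K > 0, ∀ (d : ℕ), 0 < d → ∀ (Q : EuclideanSpace ℝ (Fin d) → Matrix (Fin d) (Fin d) ℝ)
      (v u : EuclideanSpace ℝ (Fin d) → ℝ), RegularCoeff Q v →
      (∀ x, gradNorm Q x * Real.sqrt ‖act (Q x)‖ ≤ c * Real.sqrt (v x) * minEigenvalue (Q x)) →
      (∀ x, Real.sqrt ‖act (Q x)‖ * ‖grad v x‖ ≤ g * Real.sqrt (v x) ^ 3) →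
      ContDiff ℝ 2 u → HasCompactSupport u →
      ∫ x, (v x * energy Q u x) ^ (p / 2) ≤
        ε * (∫ x, |divFlux Q u x| ^ p) + K * (∫ x, |v x * u x| ^ p) := by
  set α := (p - 2) / 2 with hα
  have hα0 : 0 ≤ α := by rw [hα]; linarith
  have e₁ : α + 1 = p / 2 := by rw [hα]; ring
  have e₂ : 2 * α + 2 = p := by rw [hα]; ring
  -- The bound 1/8 allows the absorption in `weighted_integrand_lower`; ε/4 anticipates the
  -- multiplication by 4 that removes the factor 1/4 on the left.
  have hη : 0 < min (1 / 8) (ε / 4) := by positivity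
  obtain ⟨C, hC, H⟩ := exists_integral_weighted_le_zero α g c hα0 hg hc hη
  refine ⟨4 * (8 * C) ^ (α + 1), by positivity, fun d hd Q v u hQ hN hw hu hsupp => ?_⟩
  set η := min (1 / 8) (ε / 4)
  have hp0 : 0 < p := by linarith
  set S := tsupport u with hS
  have hy0 : ∀ x, 0 ≤ v x * energy Q u x := fun x =>
    mul_nonneg (hQ.pos_v x).le (hQ.energy_nonneg u x)
  have cE := (contDiff_energy hQ.smooth hu).continuous
  have cv := hQ.smooth_v.continuous
  have cu := hu.continuous
  have i₁ : Integrable fun x => (v x * energy Q u x) ^ (p / 2) := by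
    refine (integrable_abs_rpow (half_pos hp0) (cv.mul cE) hsupp fun x hx => ?_).congr
      (Eventually.of_forall fun x => ?_)
    · simp [energy_eq_zero hx]
    · simp only [Pi.mul_apply]
      rw [abs_of_nonneg (hy0 x)]
  have i₂ : Integrable fun x => |divFlux Q u x| ^ p :=
    integrable_abs_rpow hp0 (continuous_divFlux hQ.smooth hu) hsupp fun x hx => divFlux_eq_zero hx
  have i₃ : Integrable fun x => |v x * u x| ^ p :=
    integrable_abs_rpow hp0 (cv.mul cu) hsupp fun x hx => by
      simp [image_eq_zero_of_notMem_tsupport hx]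
  obtain ⟨M, hM⟩ := (show IsCompact S from hsupp).exists_bound_of_continuousOn
    (f := fun x => (v x * energy Q u x + 1) ^ α)
    (((cv.mul cE).add continuous_const).rpow_const fun x => Or.inr hα0).continuousOn
  have hSm : MeasurableSet S := (isClosed_tsupport u).measurableSet
  -- For δ ≤ 1 the error δ(vE + δ)^α is at most δM on the support of `u`. Off the support it would
  -- be a nonzero constant, not integrable, but there both sides of the inequality vanish without
  -- it.
  have i₄ : Integrable (S.indicator fun _ => max M 0) :=
    (integrable_indicator_iff hSm).mpr
      (integrableOn_const (hs := (show IsCompact S from hsupp).measure_lt_top.ne))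
  refine le_of_forall_small_le_add_mul (M := 4 * ∫ x, S.indicator (fun _ => max M 0) x)
    (mul_nonneg (by norm_num) (integral_nonneg fun x =>
      Set.indicator_nonneg (fun _ _ => le_max_right _ _) x)) fun δ hδ hδ1 => ?_
  obtain ⟨hint, hle⟩ := H d hd Q v u hQ hN hw hu hsupp δ hδ
  have key : ∀ x, (v x * energy Q u x) ^ (p / 2) / 4 - η * |divFlux Q u x| ^ p -
      (8 * C) ^ (α + 1) * |v x * u x| ^ p - δ * S.indicator (fun _ => max M 0) x ≤
      (v x * energy Q u x + δ) ^ α *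
        (v x * energy Q u x / 2 - η * divFlux Q u x ^ 2 - C * (v x * u x) ^ 2) := by
    intro x
    by_cases hx : x ∈ S
    · have h := weighted_integrand_lower (A := divFlux Q u x) (U := v x * u x) hα0 hη
        (min_le_left _ _) hC hδ (hy0 x)
      rw [e₂, e₁] at h
      rw [e₁]
      refine le_trans ?_ h
      rw [Set.indicator_of_mem hx]
      have hb : (v x * energy Q u x + δ) ^ α ≤ max M 0 := by
        refine le_trans ?_ ((le_abs_self _).trans ((hM x hx).trans (le_max_left _ _)))
        exact Real.rpow_le_rpow (add_nonneg (hy0 x) hδ.le) (by linarith) hα0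
      gcongr
    · have hu0 : u x = 0 := image_eq_zero_of_notMem_tsupport hx
      simp [energy_eq_zero hx, divFlux_eq_zero hx, hu0, Set.indicator_of_notMem hx,
        Real.zero_rpow (half_pos hp0).ne', Real.zero_rpow hp0.ne']
  have hm := mul_integral_le_of_combination_le (1 / 4) η ((8 * C) ^ (α + 1)) δ i₁ i₂ i₃ i₄ hint
    (fun x => by have := key x; linarith) hle
  have hA : η * ∫ x, |divFlux Q u x| ^ p ≤ ε / 4 * ∫ x, |divFlux Q u x| ^ p :=
    mul_le_mul_of_nonneg_right (min_le_right _ _)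
      (integral_nonneg fun x => Real.rpow_nonneg (abs_nonneg _) _)
  linarith

end LargeExponentIntegral

/-! ### The case 1 < p ≤ 2. -/

section SmallExponent

/-- Young's inequality `σ^{p-1} a ≤ η a^p + η^{-1/(p-1)} σ^p`. -/
lemma rpow_sub_one_mul_le {p η σ a : ℝ} (hp : 1 < p) (hη : 0 < η) (hσ : 0 < σ) (ha : 0 ≤ a) :
    σ ^ (p - 1) * a ≤ η * a ^ p + η ^ (-(1 / (p - 1))) * σ ^ p := by
  have hp1 : 0 < p - 1 := by linarith
  set k := η ^ (1 / (p - 1)) with hk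
  have hk0 : 0 < k := Real.rpow_pos_of_pos hη _
  have hkη : k ^ (p - 1) = η := by
    rw [hk, ← Real.rpow_mul hη.le, one_div_mul_cancel hp1.ne', Real.rpow_one]
  rw [Real.rpow_neg hη.le, ← hk]
  rcases le_total σ (k * a) with h | h
  · have ha0 : 0 < a := pos_of_mul_pos_right (hσ.trans_le h) hk0.le
    have h1 : σ ^ (p - 1) * a ≤ η * a ^ p := by
      calc σ ^ (p - 1) * a ≤ (k * a) ^ (p - 1) * a := by gcongr
        _ = η * (a ^ (p - 1) * a) := by rw [Real.mul_rpow hk0.le ha, hkη]; ring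
        _ = η * a ^ p := by rw [← Real.rpow_add_one ha0.ne', sub_add_cancel]
    have : 0 ≤ k⁻¹ * σ ^ p := by positivity
    linarith
  · have h1 : a ≤ k⁻¹ * σ := by
      rw [inv_mul_eq_div, le_div_iff₀ hk0]
      linarith
    have h2 : σ ^ (p - 1) * a ≤ k⁻¹ * σ ^ p := by
      calc σ ^ (p - 1) * a ≤ σ ^ (p - 1) * (k⁻¹ * σ) := by gcongr
        _ = k⁻¹ * (σ ^ (p - 1) * σ) := by ring
        _ = k⁻¹ * σ ^ p := by rw [← Real.rpow_add_one hσ.ne', sub_add_cancel]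
    have : 0 ≤ η * a ^ p := by positivity
    linarith

/-- Recovers y^{p/2} from the weighted quantity when β = (p-2)/2: as β ≤ 0, y^β ≤ τ^β once y ≥ τ,
and otherwise the last term suffices. -/
lemma rpow_le_rpow_mul_add {β τ y : ℝ} (hβ : β ≤ 0) (hβ' : 0 ≤ β + 1) (hτ : 0 < τ)
    (hy : 0 ≤ y) : y ^ (β + 1) ≤ τ ^ β * y + τ ^ (β + 1) := by
  rcases le_total y τ with h | h
  · have : y ^ (β + 1) ≤ τ ^ (β + 1) := by gcongr
    have : 0 ≤ τ ^ β * y := by positivity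
    linarith
  · have hy0 : 0 < y := hτ.trans_le h
    have h1 : y ^ (β + 1) ≤ τ ^ β * y := by
      rw [Real.rpow_add_one hy0.ne']
      gcongr ?_ * y
      exact Real.rpow_le_rpow_of_nonpos hτ h hβ
    have : 0 ≤ τ ^ (β + 1) := by positivity
    linarith

/-- The last parenthesis is the integrand of the energy identity for the test function v^{p-1} u (u²
+ δ)^{(p-2)/2}, with P = ⟨Q∇u, ∇v⟩. Its main term is at least (p-1) τ^β vE; half of this absorbs the
term in P, and the other half yields the left side. -/
lemma subquadratic_integrand_lower {p g η v E δ u A P : ℝ} (hp : 1 < p) (hp2 : p ≤ 2)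
    (hη : 0 < η) (hv : 0 < v) (hE : 0 ≤ E) (hδ : 0 < δ)
    (hP : |P| ≤ Real.sqrt E * (g * Real.sqrt v ^ 3)) :
    (p - 1) / 2 * (v * E) ^ (p / 2) ≤ η * |A| ^ p +
      ((p - 1) * g ^ 2 / 2 + η ^ (-(1 / (p - 1))) + (p - 1) / 2) *
        (|v * u| ^ p + δ ^ (p / 2) * v ^ p) +
      (v ^ (p - 1) * ((u ^ 2 + δ) ^ ((p - 2) / 2) +
          u * (2 * u * ((p - 2) / 2 * (u ^ 2 + δ) ^ ((p - 2) / 2 - 1)))) * E +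
        (p - 1) * v ^ (p - 2) * (u * (u ^ 2 + δ) ^ ((p - 2) / 2)) * P +
        v ^ (p - 1) * (u * (u ^ 2 + δ) ^ ((p - 2) / 2)) * A) := by
  set β := (p - 2) / 2 with hβ
  have hβ0 : β ≤ 0 := by rw [hβ]; linarith
  have hp1 : 0 < p - 1 := by linarith
  have hq : 0 < u ^ 2 + δ := by positivity
  set w := (u ^ 2 + δ) ^ β with hw
  have hw0 : 0 < w := Real.rpow_pos_of_pos hq _
  set τ := v ^ 2 * (u ^ 2 + δ) with hτ
  have hτ0 : 0 < τ := by positivity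
  set ζ := v ^ (p - 2) * w with hζ
  have hζ0 : 0 < ζ := by positivity
  -- Since v^{p-2} = (v²)^β, the weights in `v` and `u` merge into one power of τ.
  have hζτ : ζ = τ ^ β := by
    rw [hτ, Real.mul_rpow (by positivity) hq.le, ← Real.rpow_natCast v 2, ← Real.rpow_mul hv.le]
    rw [hζ, hw]
    congr 2
    rw [hβ]
    push_cast
    ring
  have hVv : v ^ (p - 1) = v ^ (p - 2) * v := by
    rw [← Real.rpow_add_one hv.ne']
    congr 1
    ring
  set y := v * E with hy
  have hy0 : 0 ≤ y := by positivity
  set b := Real.sqrt y with hb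
  have hb2 : b ^ 2 = y := Real.sq_sqrt hy0
  set U := v * |u| with hU
  have hU0 : 0 ≤ U := by positivity
  have hUτ : U ^ 2 ≤ τ := by
    rw [hU, hτ, mul_pow, sq_abs]
    gcongr
    linarith
  -- The derivative of s(s² + δ)^β stays bounded below by (p-1)(s² + δ)^β, because 2β = p - 2 ≤ 0
  -- and s² ≤ s² + δ.
  have hφ : (p - 1) * w ≤ w + u * (2 * u * (β * (u ^ 2 + δ) ^ (β - 1))) := by
    have h1 : u ^ 2 * (u ^ 2 + δ) ^ (β - 1) ≤ w := by
      calc u ^ 2 * (u ^ 2 + δ) ^ (β - 1) ≤ (u ^ 2 + δ) * (u ^ 2 + δ) ^ (β - 1) := by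
            gcongr
            linarith
        _ = w := by rw [Real.rpow_sub_one hq.ne', mul_div_cancel₀ _ hq.ne']
    have h2 : 2 * β = p - 2 := by rw [hβ]; ring
    have h3 : (2 * β) * w ≤ (2 * β) * (u ^ 2 * (u ^ 2 + δ) ^ (β - 1)) :=
      mul_le_mul_of_nonpos_left h1 (by linarith)
    rw [h2] at h3
    calc (p - 1) * w = w + (p - 2) * w := by ring
      _ ≤ w + (p - 2) * (u ^ 2 * (u ^ 2 + δ) ^ (β - 1)) := by linarith
      _ = _ := by rw [← h2]; ring
  have j₁ : (p - 1) * (ζ * y) ≤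
      v ^ (p - 1) * (w + u * (2 * u * (β * (u ^ 2 + δ) ^ (β - 1)))) * E := by
    calc (p - 1) * (ζ * y) = v ^ (p - 1) * ((p - 1) * w) * E := by rw [hVv, hζ, hy]; ring
      _ ≤ _ := by gcongr
  have j₂ : -((p - 1) * (ζ * (g * U * b))) ≤ (p - 1) * v ^ (p - 2) * (u * w) * P := by
    refine neg_le_of_abs_le ?_
    calc |(p - 1) * v ^ (p - 2) * (u * w) * P| = (p - 1) * v ^ (p - 2) * (|u| * w) * |P| := by
          rw [abs_mul, abs_mul, abs_mul u w, abs_of_pos hw0, abs_of_pos (by positivity)]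
      _ ≤ (p - 1) * v ^ (p - 2) * (|u| * w) * (Real.sqrt E * (g * Real.sqrt v ^ 3)) := by gcongr
      _ = (p - 1) * (ζ * (g * (Real.sqrt v ^ 2 * |u|) * (Real.sqrt v * Real.sqrt E))) := by
          rw [hζ]; ring
      _ = _ := by rw [Real.sq_sqrt hv.le, ← Real.sqrt_mul hv.le]
  have j₃ : -(ζ * (U * |A|)) ≤ v ^ (p - 1) * (u * w) * A := by
    refine neg_le_of_abs_le (le_of_eq ?_)
    rw [abs_mul, abs_mul, abs_mul u w, abs_of_pos hw0,
      abs_of_pos (by positivity : 0 < v ^ (p - 1)), hVv, hζ, hU]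
    ring
  have hβp : β + 1 = p / 2 := by rw [hβ]; ring
  have hττ : τ ^ β * τ = τ ^ (p / 2) := by rw [← Real.rpow_add_one hτ0.ne', hβp]
  have k₁ : ζ * (g * U * b) ≤ ζ * y / 2 + g ^ 2 / 2 * τ ^ (p / 2) := by
    have h1 : g * U * b ≤ y / 2 + g ^ 2 / 2 * τ := by
      have := sq_nonneg (g * U - b)
      have : g ^ 2 * U ^ 2 ≤ g ^ 2 * τ := by gcongr
      linarith
    calc ζ * (g * U * b) ≤ ζ * (y / 2 + g ^ 2 / 2 * τ) := by gcongr
      _ = ζ * y / 2 + g ^ 2 / 2 * (τ ^ β * τ) := by rw [hζτ]; ring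
      _ = _ := by rw [hττ]
  have k₂ : ζ * (U * |A|) ≤ η * |A| ^ p + η ^ (-(1 / (p - 1))) * τ ^ (p / 2) := by
    have h1 := rpow_sub_one_mul_le hp hη (Real.sqrt_pos.mpr hτ0) (abs_nonneg A)
    have h2 : Real.sqrt τ ^ p = τ ^ (p / 2) := by
      rw [Real.sqrt_eq_rpow, ← Real.rpow_mul hτ0.le]
      congr 1
      ring
    have h3 : τ ^ β * Real.sqrt τ = Real.sqrt τ ^ (p - 1) := by
      rw [Real.sqrt_eq_rpow, ← Real.rpow_mul hτ0.le, ← Real.rpow_add hτ0]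
      congr 1
      rw [hβ]
      ring
    rw [h2] at h1
    refine le_trans ?_ h1
    have h4 : U ≤ Real.sqrt τ := Real.le_sqrt_of_sq_le hUτ
    calc ζ * (U * |A|) ≤ ζ * (Real.sqrt τ * |A|) := by gcongr
      _ = Real.sqrt τ ^ (p - 1) * |A| := by rw [← h3, hζτ]; ring
  have k₃ := rpow_le_rpow_mul_add hβ0 (by rw [hβp]; linarith) hτ0 hy0
  rw [hβp, ← hζτ] at k₃
  have k₄ : τ ^ (p / 2) ≤ |v * u| ^ p + δ ^ (p / 2) * v ^ p := by
    have h1 : ∀ z : ℝ, (z ^ 2) ^ (p / 2) = |z| ^ p := fun z => by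
      rw [← sq_abs, ← Real.rpow_natCast, ← Real.rpow_mul (abs_nonneg z)]
      congr 1
      push_cast
      ring
    calc τ ^ (p / 2) = ((v * u) ^ 2 + v ^ 2 * δ) ^ (p / 2) := by rw [hτ]; ring_nf
      _ ≤ ((v * u) ^ 2) ^ (p / 2) + (v ^ 2 * δ) ^ (p / 2) :=
        Real.rpow_add_le_add_rpow (by positivity) (by positivity) (by linarith) (by linarith)
      _ = _ := by
        rw [h1, Real.mul_rpow (by positivity) hδ.le, h1, abs_of_pos hv]
        ring
  have hC : 0 ≤ (p - 1) * g ^ 2 / 2 + η ^ (-(1 / (p - 1))) + (p - 1) / 2 := by positivity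
  have m₁ := mul_le_mul_of_nonneg_left k₄ hC
  have m₂ := mul_le_mul_of_nonneg_left k₃ (half_pos hp1).le
  have m₃ := mul_le_mul_of_nonneg_left k₁ hp1.le
  linarith

theorem exists_integral_energy_le_of_le_two {p : ℝ} (hp : 1 < p) (hp2 : p ≤ 2) (g : ℝ) {ε : ℝ}
    (hε : 0 < ε) :
    ∃ K > 0, ∀ (d : ℕ) (Q : EuclideanSpace ℝ (Fin d) → Matrix (Fin d) (Fin d) ℝ)
      (v u : EuclideanSpace ℝ (Fin d) → ℝ), RegularCoeff Q v →
      (∀ x, Real.sqrt (quad (Q x) (grad v x)) ≤ g * Real.sqrt (v x) ^ 3) →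
      ContDiff ℝ 2 u → HasCompactSupport u →
      ∫ x, (v x * energy Q u x) ^ (p / 2) ≤
        ε * (∫ x, |divFlux Q u x| ^ p) + K * (∫ x, |v x * u x| ^ p) := by
  have hp1 : 0 < p - 1 := by linarith
  have hp0 : 0 < p := by linarith
  set η := (p - 1) / 2 * ε with hη'
  have hη : 0 < η := by positivity
  set C := (p - 1) * g ^ 2 / 2 + η ^ (-(1 / (p - 1))) + (p - 1) / 2 with hC'
  have hC : 0 < C := by positivity
  refine ⟨2 / (p - 1) * C, by positivity, fun d Q v u hQ hw hu hsupp => ?_⟩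
  have hu1 : ContDiff ℝ 1 u := hu.of_le (by norm_num)
  set S := tsupport u with hS
  have hSc : IsCompact S := hsupp
  have hy0 : ∀ x, 0 ≤ v x * energy Q u x := fun x =>
    mul_nonneg (hQ.pos_v x).le (hQ.energy_nonneg u x)
  have cE := (contDiff_energy hQ.smooth hu).continuous
  have cv := hQ.smooth_v.continuous
  have cu := hu.continuous
  have i₁ : Integrable fun x => (v x * energy Q u x) ^ (p / 2) := by
    refine (integrable_abs_rpow (half_pos hp0) (cv.mul cE) hsupp fun x hx => ?_).congr
      (Eventually.of_forall fun x => ?_)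
    · simp [energy_eq_zero hx]
    · simp only [Pi.mul_apply]
      rw [abs_of_nonneg (hy0 x)]
  have i₂ : Integrable fun x => |divFlux Q u x| ^ p :=
    integrable_abs_rpow hp0 (continuous_divFlux hQ.smooth hu) hsupp fun x hx => divFlux_eq_zero hx
  have i₃ : Integrable fun x => |v x * u x| ^ p :=
    integrable_abs_rpow hp0 (cv.mul cu) hsupp fun x hx => by
      simp [image_eq_zero_of_notMem_tsupport hx]
  have hSm : MeasurableSet S := (isClosed_tsupport u).measurableSet
  have i₄ : Integrable (S.indicator fun x => v x ^ p) :=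
    (integrable_indicator_iff hSm).mpr
      (ContinuousOn.integrableOn_compact hSc
        (cv.rpow_const fun x => Or.inr hp0.le).continuousOn)
  refine le_of_forall_small_le_add_mul
    (M := 2 / (p - 1) * C * ∫ x, S.indicator (fun x => v x ^ p) x)
    (mul_nonneg (by positivity) (integral_nonneg fun x =>
      Set.indicator_nonneg (fun y _ => Real.rpow_nonneg (hQ.pos_v y).le _) x)) fun t ht _ => ?_
  -- This makes δ^{p/2} = t, so the regularisation error is linear in `t`.
  set δ := t ^ (2 / p) with hδ'
  have hδ : 0 < δ := Real.rpow_pos_of_pos ht _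
  have hδt : δ ^ (p / 2) = t := by
    rw [hδ', ← Real.rpow_mul ht.le, div_mul_div_cancel₀ hp0.ne', div_self two_ne_zero,
      Real.rpow_one]
  set β := (p - 2) / 2 with hβ
  have hq : ∀ s : ℝ, 0 < s ^ 2 + δ := fun s => by positivity
  have hφd : ∀ s : ℝ, HasDerivAt (fun s : ℝ => s * (s ^ 2 + δ) ^ β)
      ((s ^ 2 + δ) ^ β + s * (2 * s * (β * (s ^ 2 + δ) ^ (β - 1)))) s := by
    intro s
    have h1 : HasDerivAt (fun s : ℝ => s ^ 2 + δ) (2 * s) s := by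
      simpa using (hasDerivAt_pow 2 s).add_const δ
    have h2 := (hasDerivAt_id s).mul (h1.rpow_const (p := β) (Or.inl (hq s).ne'))
    refine h2.congr_deriv ?_
    simp only [id]
    ring
  have hφC : ContDiff ℝ 1 fun x => u x * (u x ^ 2 + δ) ^ β :=
    hu1.mul (((hu1.pow 2).add contDiff_const).rpow_const_of_ne fun x => (hq (u x)).ne')
  have hvC : ContDiff ℝ 1 fun x => v x ^ (p - 1) :=
    hQ.smooth_v.rpow_const_of_ne fun x => (hQ.pos_v x).ne'
  obtain ⟨j₁, j₂⟩ := integral_weighted_energy hQ.smooth hu hsupp (hvC.mul hφC)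
  have hm := mul_integral_le_of_combination_le ((p - 1) / 2) η C (C * t) i₁ i₂ i₃ i₄ j₁
    (fun x => ?_) j₂.le
  · have h := mul_le_mul_of_nonneg_left hm (by positivity : 0 ≤ 2 / (p - 1))
    have e₁ : ∀ X : ℝ, 2 / (p - 1) * ((p - 1) / 2 * X) = X := fun X => by field_simp
    have e₂ : 2 / (p - 1) * η = ε := by rw [hη']; field_simp
    rw [e₁] at h
    refine h.trans (le_of_eq ?_)
    rw [← e₂]
    ring
  by_cases hx : x ∈ S
  · have dv : DifferentiableAt ℝ v x := hQ.smooth_v.differentiable one_ne_zero x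
    have du : DifferentiableAt ℝ u x := hu1.differentiable one_ne_zero x
    have hgr : grad (fun y => v y ^ (p - 1) * (u y * (u y ^ 2 + δ) ^ β)) x =
        (u x * (u x ^ 2 + δ) ^ β) • ((p - 1) * v x ^ (p - 2)) • grad v x +
        v x ^ (p - 1) • ((u x ^ 2 + δ) ^ β +
          u x * (2 * u x * (β * (u x ^ 2 + δ) ^ (β - 1)))) • grad u x := by
      have h1 := Real.hasDerivAt_rpow_const (p := p - 1) (Or.inl (hQ.pos_v x).ne')
      rw [show p - 1 - 1 = p - 2 by ring] at h1
      rw [grad_mul (hvC.differentiable one_ne_zero x) (hφC.differentiable one_ne_zero x),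
        grad_comp (φ := fun s => s ^ (p - 1)) h1 dv,
        grad_comp (φ := fun s => s * (s ^ 2 + δ) ^ β) (hφd (u x)) du]
    have hP : |inner ℝ (act (Q x) (grad u x)) (grad v x)| ≤
        Real.sqrt (energy Q u x) * (g * Real.sqrt (v x) ^ 3) := by
      refine (abs_inner_act_le (hQ.symm x) (hQ.quad_nonneg x) _ _).trans ?_
      exact mul_le_mul_of_nonneg_left (hw x) (Real.sqrt_nonneg _)
    have h := subquadratic_integrand_lower (u := u x) (A := divFlux Q u x) hp hp2 hη
      (hQ.pos_v x) (hQ.energy_nonneg u x) hδ hP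
    rw [hδt] at h
    refine h.trans (le_of_eq ?_)
    rw [hgr, inner_add_right, inner_smul_right, inner_smul_right, inner_smul_right,
      inner_smul_right, Set.indicator_of_mem hx,
      show inner ℝ (act (Q x) (grad u x)) (grad u x) = energy Q u x from rfl]
    ring
  · have hu0 : u x = 0 := image_eq_zero_of_notMem_tsupport hx
    have hg0 : grad u x = 0 := by
      ext i
      simp [partialD_eq_zero hx]
    simp [energy_eq_zero hx, divFlux_eq_zero hx, hu0, hg0, Set.indicator_of_notMem hx,
        Real.zero_rpow (half_pos hp0).ne', Real.zero_rpow hp0.ne']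

end SmallExponent

/-! ### The scalar interpolation inequality in L^p norms and the bound on the drift. -/

section Assembly

lemma eLpNorm_le_of_integral_rpow_le {X : Type*} [MeasurableSpace X] {ν : Measure X}
    {f g h : X → ℝ} {p a b : ℝ} (hp : 1 ≤ p) (ha : 0 ≤ a) (hb : 0 ≤ b)
    (hf : MemLp f (ENNReal.ofReal p) ν) (hg : MemLp g (ENNReal.ofReal p) ν)
    (hh : MemLp h (ENNReal.ofReal p) ν)
    (hle : ∫ x, |f x| ^ p ∂ν ≤ a ^ p * ∫ x, |g x| ^ p ∂ν + b ^ p * ∫ x, |h x| ^ p ∂ν) :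
    eLpNorm f (ENNReal.ofReal p) ν ≤
      ENNReal.ofReal a * eLpNorm g (ENNReal.ofReal p) ν +
        ENNReal.ofReal b * eLpNorm h (ENNReal.ofReal p) ν := by
  have hp0 : 0 < p := by linarith
  have h1 : ENNReal.ofReal p ≠ 0 := by simpa using hp0
  have hI : ∀ k : X → ℝ, 0 ≤ ∫ x, |k x| ^ p ∂ν := fun k =>
    integral_nonneg fun x => Real.rpow_nonneg (abs_nonneg _) _
  rw [hf.eLpNorm_eq_integral_rpow_norm h1 ENNReal.ofReal_ne_top,
    hg.eLpNorm_eq_integral_rpow_norm h1 ENNReal.ofReal_ne_top,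
    hh.eLpNorm_eq_integral_rpow_norm h1 ENNReal.ofReal_ne_top, ENNReal.toReal_ofReal hp0.le,
    ← ENNReal.ofReal_mul ha, ← ENNReal.ofReal_mul hb,
    ← ENNReal.ofReal_add (by have := hI g; positivity) (by have := hI h; positivity)]
  simp only [Real.norm_eq_abs]
  refine ENNReal.ofReal_le_ofReal ?_
  have hr : ∀ c : ℝ, 0 ≤ c → ∀ I : ℝ, 0 ≤ I → (c ^ p * I) ^ p⁻¹ = c * I ^ p⁻¹ :=
    fun c hc I hI => by
      rw [Real.mul_rpow (Real.rpow_nonneg hc _) hI, Real.rpow_rpow_inv hc hp0.ne']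
  calc _ ≤ (a ^ p * ∫ x, |g x| ^ p ∂ν + b ^ p * ∫ x, |h x| ^ p ∂ν) ^ p⁻¹ :=
        Real.rpow_le_rpow (hI f) hle (by positivity)
    _ ≤ (a ^ p * ∫ x, |g x| ^ p ∂ν) ^ p⁻¹ + (b ^ p * ∫ x, |h x| ^ p ∂ν) ^ p⁻¹ :=
        Real.rpow_add_le_add_rpow (mul_nonneg (Real.rpow_nonneg ha _) (hI g))
          (mul_nonneg (Real.rpow_nonneg hb _) (hI h)) (by positivity)
          (inv_le_one_of_one_le₀ hp)
    _ = _ := by rw [hr a ha _ (hI g), hr b hb _ (hI h)]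

section Coefficients

variable {d m : ℕ} {p κ θ c₀ c₁ c₂ γ Cγ : ℝ}
  {Q : EuclideanSpace ℝ (Fin d) → Matrix (Fin d) (Fin d) ℝ}
  {B : Fin d → EuclideanSpace ℝ (Fin d) → Matrix (Fin m) (Fin m) ℝ}
  {V : EuclideanSpace ℝ (Fin d) → Matrix (Fin m) (Fin m) ℝ}
  {v : EuclideanSpace ℝ (Fin d) → ℝ}

lemma Hyp.le_v (h : Hyp p κ θ c₀ c₁ c₂ γ Cγ Q B V v) (x : EuclideanSpace ℝ (Fin d)) :
    c₀ ≤ v x :=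
  h.v_inf.1 ⟨x, rfl⟩

lemma Hyp.regularCoeff (h : Hyp p κ θ c₀ c₁ c₂ γ Cγ Q B V v) : RegularCoeff Q v where
  symm := h.Q_symm
  smooth := h.Q_smooth
  pos := h.Q_pos
  smooth_v := h.v_smooth
  pos_v x := h.c₀_pos.trans_le (h.le_v x)

/-- As v ≥ c₀ > 0, the additive constant is itself a multiple of v^{3/2}. This is how the final
constant comes to depend on `c₀`. -/
lemma Hyp.growth_le (h : Hyp p κ θ c₀ c₁ c₂ γ Cγ Q B V v) (x : EuclideanSpace ℝ (Fin d)) :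
    γ * v x ^ (3 / 2 : ℝ) + Cγ ≤ (γ + Cγ / Real.sqrt c₀ ^ 3) * Real.sqrt (v x) ^ 3 := by
  have hv := h.regularCoeff.pos_v x
  have h1 : v x ^ (3 / 2 : ℝ) = Real.sqrt (v x) ^ 3 := by
    rw [Real.sqrt_eq_rpow, ← Real.rpow_natCast, ← Real.rpow_mul hv.le]
    norm_num
  have hc : 0 < Real.sqrt c₀ ^ 3 := pow_pos (Real.sqrt_pos.mpr h.c₀_pos) 3
  have h2 : Cγ ≤ Cγ / Real.sqrt c₀ ^ 3 * Real.sqrt (v x) ^ 3 := by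
    have := h.Cγ_pos
    calc Cγ = Cγ / Real.sqrt c₀ ^ 3 * Real.sqrt c₀ ^ 3 :=
          (div_mul_cancel₀ _ hc.ne').symm
      _ ≤ _ := by
        gcongr
        exact h.le_v x
  rw [h1, add_mul]
  linarith

/-- The oscillation condition at the centre y = x, multiplied by |Q|^{1/2} = ρ v^{1/2}. -/
lemma Hyp.gradNorm_mul_le (h : Hyp p κ θ c₀ c₁ c₂ γ Cγ Q B V v) (hp : 2 < p) (hd : 0 < d)
    (x : EuclideanSpace ℝ (Fin d)) :
    gradNorm Q x * Real.sqrt ‖act (Q x)‖ ≤ c₂ * Real.sqrt (v x) * minEigenvalue (Q x) := by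
  have hμ := minEigenvalue_pos hd (h.Q_symm x) (h.Q_pos x)
  have hc := h.c₂_pos
  have hr : 0 ≤ radius Q v x := div_nonneg (Real.sqrt_nonneg _) (Real.sqrt_nonneg _)
  have ho := h.Q_osc hp x x (by simpa using hr)
  rcases (Real.sqrt_nonneg ‖act (Q x)‖).eq_or_lt' with h0 | h0
  · rw [h0, mul_zero]
    positivity
  · have hv : 0 < Real.sqrt (v x) := Real.sqrt_pos.mpr (h.regularCoeff.pos_v x)
    calc _ ≤ c₂ * minEigenvalue (Q x) / radius Q v x * Real.sqrt ‖act (Q x)‖ := by gcongr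
      _ = c₂ * Real.sqrt (v x) * minEigenvalue (Q x) := by
        rw [radius]
        field_simp

lemma Hyp.v_mul_norm_le (h : Hyp p κ θ c₀ c₁ c₂ γ Cγ Q B V v) (x : EuclideanSpace ℝ (Fin d))
    (ξ : EuclideanSpace ℝ (Fin m)) : v x * ‖ξ‖ ≤ ‖act (V x) ξ‖ := by
  by_cases hξ : ξ = 0
  · simp [hξ]
  · refine le_of_mul_le_mul_right (a := ‖ξ‖) ?_ (norm_pos_iff.mpr hξ)
    calc v x * ‖ξ‖ * ‖ξ‖ = v x * ‖ξ‖ ^ 2 := by ring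
      _ ≤ quad (V x) ξ := h.V_lower x ξ
      _ ≤ _ := real_inner_le_norm _ _

end Coefficients

/-- The scalar interpolation inequality. -/
theorem exists_eLpNorm_energy_le {p c₀ c₂ γ Cγ ε : ℝ} (hp : 1 < p) (hγ : 0 < γ) (hCγ : 0 < Cγ)
    (hc₂ : 0 < c₂) (hε : 0 < ε) :
    ∃ K > 0, ∀ (d m : ℕ) (κ θ c₁ : ℝ)
      (Q : EuclideanSpace ℝ (Fin d) → Matrix (Fin d) (Fin d) ℝ)
      (B : Fin d → EuclideanSpace ℝ (Fin d) → Matrix (Fin m) (Fin m) ℝ)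
      (V : EuclideanSpace ℝ (Fin d) → Matrix (Fin m) (Fin m) ℝ)
      (v u : EuclideanSpace ℝ (Fin d) → ℝ), 0 < d → Hyp p κ θ c₀ c₁ c₂ γ Cγ Q B V v →
      ContDiff ℝ 2 u → HasCompactSupport u →
      eLpNorm (fun x => Real.sqrt (v x) * Real.sqrt (energy Q u x)) (ENNReal.ofReal p) ≤
        ENNReal.ofReal ε * eLpNorm (divFlux Q u) (ENNReal.ofReal p) +
          ENNReal.ofReal K * eLpNorm (fun x => v x * u x) (ENNReal.ofReal p) := by
  have hp0 : 0 < p := by linarith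
  have hεp : 0 < ε ^ p := Real.rpow_pos_of_pos hε p
  set g := γ + Cγ / Real.sqrt c₀ ^ 3 with hgdef
  have hg : 0 ≤ g := by positivity
  have key : ∃ K > 0, ∀ (d m : ℕ) (κ θ c₁ : ℝ)
      (Q : EuclideanSpace ℝ (Fin d) → Matrix (Fin d) (Fin d) ℝ)
      (B : Fin d → EuclideanSpace ℝ (Fin d) → Matrix (Fin m) (Fin m) ℝ)
      (V : EuclideanSpace ℝ (Fin d) → Matrix (Fin m) (Fin m) ℝ)
      (v u : EuclideanSpace ℝ (Fin d) → ℝ), 0 < d → Hyp p κ θ c₀ c₁ c₂ γ Cγ Q B V v →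
      ContDiff ℝ 2 u → HasCompactSupport u →
      ∫ x, (v x * energy Q u x) ^ (p / 2) ≤
        ε ^ p * (∫ x, |divFlux Q u x| ^ p) + K * (∫ x, |v x * u x| ^ p) := by
    rcases le_or_gt p 2 with hp2 | hp2
    · obtain ⟨K, hK, H⟩ := exists_integral_energy_le_of_le_two hp hp2 g hεp
      refine ⟨K, hK, fun d m κ θ c₁ Q B V v u _ h hu hc =>
        H d Q v u h.regularCoeff (fun x => ?_) hu hc⟩
      rw [← gradient_eq_grad (h.v_smooth.differentiable one_ne_zero x)]
      exact (h.osc_le hp2 x).trans (h.growth_le x)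
    · obtain ⟨K, hK, H⟩ := exists_integral_energy_le_of_two_lt hp2 g c₂ hg hc₂.le hεp
      refine ⟨K, hK, fun d m κ θ c₁ Q B V v u hd h hu hc =>
        H d hd Q v u h.regularCoeff (h.gradNorm_mul_le hp2 hd) (fun x => ?_) hu hc⟩
      rw [← gradient_eq_grad (h.v_smooth.differentiable one_ne_zero x)]
      exact (h.osc_gt hp2 x).trans (h.growth_le x)
  obtain ⟨K, hK, H⟩ := key
  refine ⟨K ^ p⁻¹, Real.rpow_pos_of_pos hK _, fun d m κ θ c₁ Q B V v u hd h hu hc => ?_⟩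
  have hQ := h.regularCoeff
  have cE := (contDiff_energy hQ.smooth hu).continuous
  have cv := hQ.smooth_v.continuous
  refine eLpNorm_le_of_integral_rpow_le hp.le hε.le (Real.rpow_nonneg hK.le _) ?_ ?_ ?_ ?_
  · exact Continuous.memLp_of_hasCompactSupport (cv.sqrt.mul cE.sqrt)
      (HasCompactSupport.intro hc fun x hx => by simp [energy_eq_zero hx])
  · exact Continuous.memLp_of_hasCompactSupport (continuous_divFlux hQ.smooth hu)
      (HasCompactSupport.intro hc fun x hx => divFlux_eq_zero hx)
  · exact Continuous.memLp_of_hasCompactSupport (cv.mul hu.continuous) hc.mul_left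
  · rw [Real.rpow_inv_rpow hK.le hp0.ne']
    refine le_trans (le_of_eq ?_) (H d m κ θ c₁ Q B V v u hd h hu hc)
    refine integral_congr_ae (Eventually.of_forall fun x => ?_)
    have hy : 0 ≤ v x * energy Q u x := mul_nonneg (hQ.pos_v x).le (hQ.energy_nonneg u x)
    simp only
    rw [← Real.sqrt_mul (hQ.pos_v x).le, abs_of_nonneg (Real.sqrt_nonneg _), Real.sqrt_eq_rpow,
      ← Real.rpow_mul hy]
    congr 1
    ring

lemma norm_le_sum_abs {m : ℕ} (z : EuclideanSpace ℝ (Fin m)) : ‖z‖ ≤ ∑ k, |z k| := by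
  refine le_of_sq_le_sq ?_ (Finset.sum_nonneg fun _ _ => abs_nonneg _)
  rw [EuclideanSpace.norm_sq_eq]
  exact Finset.sum_sq_le_sq_sum_of_nonneg fun _ _ => abs_nonneg _

lemma partialD_apply {d m : ℕ} {u : EuclideanSpace ℝ (Fin d) → EuclideanSpace ℝ (Fin m)}
    {x : EuclideanSpace ℝ (Fin d)} (hu : DifferentiableAt ℝ u x) (i : Fin d) (k : Fin m) :
    partialD i u x k = partialD i (fun z => u z k) x := by
  have h := ((EuclideanSpace.proj (𝕜 := ℝ) k).hasFDerivAt.comp x hu.hasFDerivAt).fderiv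
  unfold partialD
  rw [show (fun z => u z k) = (EuclideanSpace.proj (𝕜 := ℝ) k) ∘ u from rfl, h]
  rfl

/-- The structural bound on the B^i, taken at η^k = ∇u_k, removes the coupling between the
components. -/
lemma Hyp.norm_drift_le {d m : ℕ} {p κ θ c₀ c₁ c₂ γ Cγ : ℝ}
    {Q : EuclideanSpace ℝ (Fin d) → Matrix (Fin d) (Fin d) ℝ}
    {B : Fin d → EuclideanSpace ℝ (Fin d) → Matrix (Fin m) (Fin m) ℝ}
    {V : EuclideanSpace ℝ (Fin d) → Matrix (Fin m) (Fin m) ℝ}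
    {v : EuclideanSpace ℝ (Fin d) → ℝ} (h : Hyp p κ θ c₀ c₁ c₂ γ Cγ Q B V v)
    {u : EuclideanSpace ℝ (Fin d) → EuclideanSpace ℝ (Fin m)} {x : EuclideanSpace ℝ (Fin d)}
    (hu : DifferentiableAt ℝ u x) :
    ‖drift B u x‖ ≤
      ∑ k, κ * (Real.sqrt (v x) * Real.sqrt (energy Q (fun z => u z k) x)) := by
  have e : ∀ l, drift B u x l = ∑ k, ∑ i, B i x l k * grad (fun z => u z k) x i := by
    intro l
    simp only [drift, WithLp.ofLp_sum, Finset.sum_apply, act_apply, grad_apply,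
      partialD_apply hu]
    exact Finset.sum_comm
  calc ‖drift B u x‖ ≤ ∑ l, |drift B u x l| := norm_le_sum_abs _
    _ ≤ ∑ l, ∑ k, |∑ i, B i x l k * grad (fun z => u z k) x i| := by
      refine Finset.sum_le_sum fun l _ => ?_
      rw [e l]
      exact Finset.abs_sum_le_sum_abs _ _
    _ ≤ κ * Real.sqrt (v x) * ∑ k, Real.sqrt (quad (Q x) (grad (fun z => u z k) x)) :=
      h.B_bound x fun k => grad (fun z => u z k) x
    _ = _ := by
      rw [Finset.mul_sum]
      exact Finset.sum_congr rfl fun k _ => by rw [mul_assoc]; rfl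

end Assembly

end VectorElliptic

end

/-! ### The vector-valued estimate, by summation over components. -/

theorem mainTheorem10 (d m : ℕ) (p κ c₀ c₁ c₂ γ Cγ : ℝ) (hp : 1 < p)
    (hγ : p < 2 → γ ^ 2 ≤ 4 / (p - 1)) (ε : ℝ) (hε : 0 < ε) :
    ∃ K : ℝ, 0 < K ∧
      ∀ (θ : ℝ)
        (Q : EuclideanSpace ℝ (Fin d) → Matrix (Fin d) (Fin d) ℝ)
        (B : Fin d → EuclideanSpace ℝ (Fin d) → Matrix (Fin m) (Fin m) ℝ)
        (V : EuclideanSpace ℝ (Fin d) → Matrix (Fin m) (Fin m) ℝ)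
        (v : EuclideanSpace ℝ (Fin d) → ℝ),
        VectorElliptic.Hyp p κ θ c₀ c₁ c₂ γ Cγ Q B V v →
        ∀ u : EuclideanSpace ℝ (Fin d) → EuclideanSpace ℝ (Fin m),
          ContDiff ℝ ∞ u → HasCompactSupport u →
          eLpNorm (VectorElliptic.drift B u) (ENNReal.ofReal p) volume ≤
            ENNReal.ofReal ε *
                eLpNorm (VectorElliptic.opA0 Q u) (ENNReal.ofReal p) volume +
              ENNReal.ofReal K *
                eLpNorm (fun x => VectorElliptic.act (V x) (u x)) (ENNReal.ofReal p) volume := by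
  -- `K` is chosen before the coefficients, whose hypotheses carry these signs; if a sign fails, no
  -- coefficients are admissible and any `K` works.
  by_cases hpos : 0 < κ ∧ 0 < c₂ ∧ 0 < γ ∧ 0 < Cγ
  swap
  · exact ⟨1, one_pos, fun θ Q B V v h =>
      absurd ⟨h.κ_pos, h.c₂_pos, h.γ_pos, h.Cγ_pos⟩ hpos⟩
  obtain ⟨hκ, hc₂, hγ0, hCγ⟩ := hpos
  -- Summing `m` components costs κm; dividing by m + 1 rather than `m` also covers m = 0.
  have hε' : 0 < ε / (κ * (m + 1)) := by positivity
  obtain ⟨K, hK, H⟩ := VectorElliptic.exists_eLpNorm_energy_le (c₀ := c₀) hp hγ0 hCγ hc₂ hε'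
  refine ⟨κ * (m + 1) * K, by positivity, fun θ Q B V v h u hu hc => ?_⟩
  -- For d = 0 the drift is an empty sum; the scalar inequality needs d > 0 for the least eigenvalue
  -- to be positive.
  rcases Nat.eq_zero_or_pos d with rfl | hd
  · have : VectorElliptic.drift B u = 0 := by
      funext x
      simp [VectorElliptic.drift]
    simp [this]
  set P := ENNReal.ofReal p
  have hP : 1 ≤ P := ENNReal.one_le_ofReal.mpr hp.le
  have hQ := h.regularCoeff
  have huk : ∀ k, ContDiff ℝ 2 fun z => u z k := fun k =>
    mod_cast contDiff_infty.mp (contDiff_euclidean.mp hu k) 2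
  have hck : ∀ k, HasCompactSupport fun z => u z k := fun k =>
    hc.comp_left (g := fun w : EuclideanSpace ℝ (Fin m) => w k) rfl
  set b : Fin m → EuclideanSpace ℝ (Fin d) → ℝ := fun k x =>
    Real.sqrt (v x) * Real.sqrt (VectorElliptic.energy Q (fun z => u z k) x) with hb
  have hbc : ∀ k, Continuous (b k) := fun k =>
    hQ.smooth_v.continuous.sqrt.mul
      (VectorElliptic.contDiff_energy hQ.smooth (huk k)).continuous.sqrt
  have hA : ∀ k, eLpNorm (VectorElliptic.divFlux Q fun z => u z k) P volume ≤
      eLpNorm (VectorElliptic.opA0 Q u) P volume := fun k =>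
    eLpNorm_mono fun x => PiLp.norm_apply_le (VectorElliptic.opA0 Q u x) k
  have hV : ∀ k, eLpNorm (fun x => v x * u x k) P volume ≤
      eLpNorm (fun x => VectorElliptic.act (V x) (u x)) P volume := fun k =>
    eLpNorm_mono fun x => by
      rw [norm_mul, Real.norm_of_nonneg (hQ.pos_v x).le]
      exact (mul_le_mul_of_nonneg_left (PiLp.norm_apply_le (u x) k) (hQ.pos_v x).le).trans
        (h.v_mul_norm_le x (u x))
  have hbk : ∀ k, eLpNorm (κ • b k) P volume ≤ ENNReal.ofReal κ *
      (ENNReal.ofReal (ε / (κ * (m + 1))) * eLpNorm (VectorElliptic.opA0 Q u) P volume +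
        ENNReal.ofReal K * eLpNorm (fun x => VectorElliptic.act (V x) (u x)) P volume) := by
    intro k
    rw [eLpNorm_const_smul, Real.enorm_of_nonneg hκ.le]
    gcongr
    refine (H d m κ θ c₁ Q B V v _ hd h (huk k) (hck k)).trans ?_
    gcongr
    · exact hA k
    · exact hV k
  calc eLpNorm (VectorElliptic.drift B u) P volume ≤ eLpNorm (∑ k, κ • b k) P volume := by
        refine eLpNorm_mono fun x => ?_
        refine (h.norm_drift_le (hu.differentiable (by simp) x)).trans ?_
        refine le_trans (le_of_eq ?_) (le_abs_self _)
        simp [hb]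
    _ ≤ ∑ k, eLpNorm (κ • b k) P volume :=
        eLpNorm_sum_le (fun k _ => ((hbc k).const_smul κ).aestronglyMeasurable) hP
    _ ≤ ∑ _k : Fin m, ENNReal.ofReal κ *
        (ENNReal.ofReal (ε / (κ * (m + 1))) * eLpNorm (VectorElliptic.opA0 Q u) P volume +
        ENNReal.ofReal K * eLpNorm (fun x => VectorElliptic.act (V x) (u x)) P volume) :=
        Finset.sum_le_sum fun k _ => hbk k
    _ = ENNReal.ofReal (m * (κ * (ε / (κ * (m + 1))))) *
          eLpNorm (VectorElliptic.opA0 Q u) P volume +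
        ENNReal.ofReal (κ * m * K) *
          eLpNorm (fun x => VectorElliptic.act (V x) (u x)) P volume := by
        rw [Finset.sum_const, Finset.card_univ, Fintype.card_fin, nsmul_eq_mul,
          ENNReal.ofReal_mul (Nat.cast_nonneg m), mul_assoc κ, ENNReal.ofReal_mul hκ.le,
          ENNReal.ofReal_mul hκ.le, ENNReal.ofReal_mul (Nat.cast_nonneg m), ENNReal.ofReal_natCast]
        ring
    _ ≤ _ := by
        gcongr
        · rw [show (m : ℝ) * (κ * (ε / (κ * (m + 1)))) = ε * (m / (m + 1)) by field_simp]
          exact mul_le_of_le_one_right hε.le (div_le_one_of_le₀ (by linarith) (by positivity))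
        · linarith
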